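/- Let $\ell>0$. All functions are complex-valued. An \emph{impedance} is a function $f\in W^{1,2}(0,\ell)\subset C[0,\ell]$ (absolutely continuous on $[0,\ell]$ with $f'\in L^2(0,\ell)$) that does not vanish on $[0,\ell]$ and satisfies $f(0)=1$. For an impedance $f$ put $$\sigma_f(x)=\frac{f'(x)}{f(x)}+\int_0^x\Big(\frac{f'(t)}{f(t)}\Big)^2dt,\qquad (q_f\,|\,\varphi)=\int_0^\ell\Big\{\Big(\frac{f'}{f}\Big)^2\varphi-\frac{f'}{f}\varphi'\Big\}dx\quad(\varphi\in W^{1,2}_0(0,\ell)),$$ so that $q_f=f''/f=\sigma_f'\in W^{-1,2}(0,\ell)$, and $\mathbf D_fy=y'-\frac{f'}{f}y$. For $\rho\in\mathbb C$ let $e_f(\rho,\cdot)\in W^{1,2}(0,\ell)$ be the unique solution of $$-y''+q_fy=\rho^2y\ \text{ on }(0,\ell),\qquad y(0)=1,\quad \mathbf D_fy(0)=i\rho,$$ where the equation means $\int_0^\ell y'\varphi'\,dx+(q_f\,|\,y\varphi)=\rho^2\int_0^\ell y\varphi\,dx$ for all $\varphi\in W^{1,2}_0(0,\ell)$; for such $y$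 the function $\mathbf D_fy$ belongs to $W^{1,2}(0,\ell)$, and its value at $0$ is that of its continuous representative. Let $\mathcal T_\ell=\{(x,t)\in\mathbb R^2: 0\le x\le\ell,\ |t|\le x\}$. For every impedance $f$ let $K_f\in L^2(\mathcal T_\ell)$, with $K_f(x,\cdot)\in L^2(-x,x)$ for every $x\in(0,\ell]$, be the kernel such that $$e_f(\rho,x)=e^{i\rho x}+\int_{-x}^{x}K_f(x,t)e^{i\rho t}\,dt\qquad(\rho\in\mathbb C,\ 0<x\le\ell),$$ and let $$\mathbf T_fu(x)=u(x)+\int_{-x}^xK_f(x,t)u(t)\,dt .$$ Let $f$ be an impedance and let $f_n\in C^\infty[0,\ell]$, $n\in\mathbb N$, be impedances such that $$f_n\to f\ \text{ and }\ \tfrac1{f_n}\to\tfrac1f\ \text{ in }W^{1,2}(0,\ell),\qquad \sigma_{f_n}\to\sigma_f\ \text{ in }L^2(0,\ell),\qquad q_{f_n}\to q_f\ \text{ in }W^{-1,2}(0,\ell).$$ Then the kernels $K_f$ and $K_{f_n}$ exist and are unique (for each $x\in(0,\ell]$, up to equality for almost every $t\in(-x,x)$), the operators $\mathbf T_f,\mathbf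 T_{f_n}$ belong to $\mathcal B(L^2(-\ell,\ell),L^2(0,\ell))$ and to $\mathcal B(C[-\ell,\ell],C[0,\ell])$, and $$\mathbf T_{f_n}\to\mathbf T_f\ \text{ in the strong operator topology of }\mathcal B(L^2(-\ell,\ell),L^2(0,\ell))\text{ and of }\mathcal B(C[-\ell,\ell],C[0,\ell]),$$ that is, $\mathbf T_{f_n}u\to\mathbf T_fu$ in $L^2(0,\ell)$ for every $u\in L^2(-\ell,\ell)$, and uniformly on $[0,\ell]$ for every $u\in C[-\ell,\ell]$. Moreover $K_{f_n}\rightharpoonup K_f$ weakly in $L^2(\mathcal T_\ell)$. -/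

import Mathlib

open MeasureTheory Set Filter Topology
open scoped ContDiff

noncomputable section

namespace Transmutation

/-- Lebesgue measure on the open interval `(0, ℓ)`. -/
abbrev μ₀ (ℓ : ℝ) : Measure ℝ := volume.restrict (Ioo 0 ℓ)

/-- Lebesgue measure on the open interval `(-ℓ, ℓ)`. -/
abbrev μ₁ (ℓ : ℝ) : Measure ℝ := volume.restrict (Ioo (-ℓ) ℓ)

/-- The closed triangle `0 ≤ x ≤ ℓ`, `|t| ≤ x`; points are pairs `(x, t)`. -/
def triangle (ℓ : ℝ) : Set (ℝ × ℝ) := {p | 0 ≤ p.1 ∧ p.1 ≤ ℓ ∧ |p.2| ≤ p.1}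

/-- Lebesgue measure on the triangle. -/
abbrev μT (ℓ : ℝ) : Measure (ℝ × ℝ) := volume.restrict (triangle ℓ)

/-! ### Sobolev spaces on `(0, ℓ)` -/

/-- `u` restricted to `[0, ℓ]` is (the continuous representative of) an element of
`W^{1,2}(0, ℓ)`: it is absolutely continuous on `[0, ℓ]` and its derivative, which exists
almost everywhere, is square integrable. -/
structure MemW12 (ℓ : ℝ) (u : ℝ → ℂ) : Prop where
  ac : AbsolutelyContinuousOnInterval u 0 ℓ
  deriv_memLp : MemLp (deriv u) 2 (μ₀ ℓ)

/-- `W₀^{1,2}(0, ℓ)`: the elements of `W^{1,2}(0, ℓ)` that vanish at both end points. -/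
structure MemW12Zero (ℓ : ℝ) (φ : ℝ → ℂ) : Prop where
  memW12 : MemW12 ℓ φ
  left : φ 0 = 0
  right : φ ℓ = 0

/-- The norm of `W^{1,2}(0, ℓ)`. -/
def w12Norm (ℓ : ℝ) (u : ℝ → ℂ) : ℝ :=
  Real.sqrt ((eLpNorm u 2 (μ₀ ℓ)).toReal ^ 2 + (eLpNorm (deriv u) 2 (μ₀ ℓ)).toReal ^ 2)

/-- Convergence `u n → v` in the norm of `L²(0, ℓ)`. -/
def TendstoL2 (ℓ : ℝ) (u : ℕ → ℝ → ℂ) (v : ℝ → ℂ) : Prop :=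
  Tendsto (fun n => eLpNorm (fun x => u n x - v x) 2 (μ₀ ℓ)) atTop (𝓝 0)

/-- Convergence `u n → v` in the norm of `W^{1,2}(0, ℓ)`. -/
def TendstoW12 (ℓ : ℝ) (u : ℕ → ℝ → ℂ) (v : ℝ → ℂ) : Prop :=
  TendstoL2 ℓ u v ∧ TendstoL2 ℓ (fun n => deriv (u n)) (deriv v)

/-- Convergence `q n → p` of functionals on `W₀^{1,2}(0, ℓ)` in the norm of the dual space
`W^{-1,2}(0, ℓ)`. -/
def TendstoWNeg12 (ℓ : ℝ) (q : ℕ → (ℝ → ℂ) → ℂ) (p : (ℝ → ℂ) → ℂ) : Prop :=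
  ∀ ε : ℝ, 0 < ε → ∀ᶠ n in atTop, ∀ φ : ℝ → ℂ, MemW12Zero ℓ φ →
    ‖q n φ - p φ‖ ≤ ε * w12Norm ℓ φ

/-! ### Impedances, the distributional potential `f''/f`, and the Schrödinger equation -/

/-- `f ∈ W^{1,2}(0, ℓ)` does not vanish on `[0, ℓ]` and is normalized by `f 0 = 1`. -/
structure IsImpedance (ℓ : ℝ) (f : ℝ → ℂ) : Prop where
  memW12 : MemW12 ℓ f
  ne_zero : ∀ x ∈ Icc 0 ℓ, f x ≠ 0
  normalized : f 0 = 1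

/-- The logarithmic derivative `f'/f`. -/
def logD (f : ℝ → ℂ) (x : ℝ) : ℂ := deriv f x / f x

/-- The antiderivative `σ_f = f'/f + ∫₀ˣ (f'/f)²` of the potential `f''/f`. -/
def sigma (f : ℝ → ℂ) (x : ℝ) : ℂ := logD f x + ∫ t in (0 : ℝ)..x, logD f t ^ 2

/-- The distribution `q_f = f''/f ∈ W^{-1,2}(0, ℓ)`:
`(q_f | φ) = ∫ (f'/f)² φ - (f'/f) φ'` for `φ ∈ W₀^{1,2}(0, ℓ)`. -/
def potential (ℓ : ℝ) (f φ : ℝ → ℂ) : ℂ :=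
  ∫ x in (0 : ℝ)..ℓ, (logD f x ^ 2 * φ x - logD f x * deriv φ x)

/-- The distribution `S_f y = -y'' + q_f y`:
`(S_f y | φ) = ∫ y' φ' + (q_f | y φ)` for `φ ∈ W₀^{1,2}(0, ℓ)`. -/
def schrodinger (ℓ : ℝ) (f y φ : ℝ → ℂ) : ℂ :=
  (∫ x in (0 : ℝ)..ℓ, deriv y x * deriv φ x) + potential ℓ f (fun x => y x * φ x)

/-- `D_f y = y' - (f'/f) y`. -/
def quasiDeriv (f y : ℝ → ℂ) (x : ℝ) : ℂ := deriv y x - logD f x * y x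

/-- `y` is the solution `e_f(ρ, ·)` of the Cauchy problem `-y'' + q_f y = ρ² y` on `(0, ℓ)`,
`y 0 = 1`, `(D_f y) 0 = iρ`. The value of `D_f y` at `0` is that of its continuous
representative `w`. -/
structure IsExpSolution (ℓ : ℝ) (f : ℝ → ℂ) (ρ : ℂ) (y : ℝ → ℂ) : Prop where
  memW12 : MemW12 ℓ y
  equation : ∀ φ : ℝ → ℂ, MemW12Zero ℓ φ →
    schrodinger ℓ f y φ = ∫ x in (0 : ℝ)..ℓ, ρ ^ 2 * y x * φ x
  init : y 0 = 1
  init_quasi : ∃ w : ℝ → ℂ, MemW12 ℓ w ∧ w =ᵐ[μ₀ ℓ] quasiDeriv f y ∧ w 0 = Complex.I * ρ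

/-! ### The transmutation kernel and operator -/

/-- `K ∈ L²(𝒯_ℓ)`, with slices `K(x, ·) ∈ L²(-x, x)`, represents the solutions `e_f(ρ, ·)`:
`e_f(ρ, x) = exp(iρx) + ∫_{-x}^{x} K(x, t) exp(iρt) dt` for all `ρ ∈ ℂ`, `x ∈ (0, ℓ]`. -/
structure IsTransmutationKernel (ℓ : ℝ) (f : ℝ → ℂ) (K : ℝ → ℝ → ℂ) : Prop where
  memLp : MemLp (fun p : ℝ × ℝ => K p.1 p.2) 2 (μT ℓ)
  slice : ∀ x ∈ Ioc 0 ℓ, MemLp (K x) 2 (μ₁ x)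
  representation : ∀ ρ : ℂ, ∃ y : ℝ → ℂ, IsExpSolution ℓ f ρ y ∧
    ∀ x ∈ Ioc 0 ℓ, y x = Complex.exp (Complex.I * ρ * x) +
      ∫ t in (-x)..x, K x t * Complex.exp (Complex.I * ρ * t)

/-- `K` is a transmutation kernel for `f`, and the only one up to null sets in `t`. -/
def IsUniqueTransmutationKernel (ℓ : ℝ) (f : ℝ → ℂ) (K : ℝ → ℝ → ℂ) : Prop :=
  IsTransmutationKernel ℓ f K ∧
    ∀ K' : ℝ → ℝ → ℂ, IsTransmutationKernel ℓ f K' → ∀ x ∈ Ioc 0 ℓ, K' x =ᵐ[μ₁ x] K x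

/-- The transmutation kernel `K_f`. -/
def kernel (ℓ : ℝ) (f : ℝ → ℂ) : ℝ → ℝ → ℂ := Classical.epsilon (IsTransmutationKernel ℓ f)

/-- `T_f u (x) = u(x) + ∫_{-x}^{x} K_f(x, t) u(t) dt`. -/
def transmute (ℓ : ℝ) (f u : ℝ → ℂ) (x : ℝ) : ℂ := u x + ∫ t in (-x)..x, kernel ℓ f x t * u t

/-- `T` is the operator `T_f` as an element of `B(L²(-ℓ, ℓ), L²(0, ℓ))`. -/
def IsTransmutationL2 (ℓ : ℝ) (f : ℝ → ℂ)
    (T : Lp ℂ 2 (μ₁ ℓ) →L[ℂ] Lp ℂ 2 (μ₀ ℓ)) : Prop :=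
  ∀ u : Lp ℂ 2 (μ₁ ℓ), T u =ᵐ[μ₀ ℓ] transmute ℓ f u

/-- `S` is the operator `T_f` as an element of `B(C[-ℓ, ℓ], C[0, ℓ])`. -/
def IsTransmutationC (ℓ : ℝ) (hℓ : 0 < ℓ) (f : ℝ → ℂ)
    (S : C(Icc (-ℓ) ℓ, ℂ) →L[ℂ] C(Icc (0 : ℝ) ℓ, ℂ)) : Prop :=
  ∀ (u : C(Icc (-ℓ) ℓ, ℂ)) (x : Icc (0 : ℝ) ℓ),
    S u x = transmute ℓ f (IccExtend (neg_le_self hℓ.le) u) x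

/-- `F n → f` in the sense that `F n → f` and `1/F n → 1/f` in `W^{1,2}(0, ℓ)`,
`σ_{F n} → σ_f` in `L²(0, ℓ)` and `q_{F n} → q_f` in `W^{-1,2}(0, ℓ)`. -/
structure ImpedanceTendsto (ℓ : ℝ) (F : ℕ → ℝ → ℂ) (f : ℝ → ℂ) : Prop where
  tendsto : TendstoW12 ℓ F f
  tendsto_inv : TendstoW12 ℓ (fun n x => (F n x)⁻¹) (fun x => (f x)⁻¹)
  tendsto_sigma : TendstoL2 ℓ (fun n => sigma (F n)) (sigma f)
  tendsto_potential : TendstoWNeg12 ℓ (fun n => potential ℓ (F n)) (potential ℓ f)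

end Transmutation

end

noncomputable section
namespace Transmutation

/-! ### Absolutely continuous complex functions and `W^{1,2}` -/

/-! Put a = f'/f, which lies in L²(0, ℓ). With w = D_f y the equation -y'' + q_f y = ρ²y becomes the
first order system y' = ay + w, w' = -aw - ρ²y, whose only coefficient is a. Let z_a(ρ) (`jost`)
solve z(ρ)' = iρ z(ρ) + a z(-ρ), z(ρ)(0) = 1. The part of z_a even in ρ gives the solution of the
system with data (1, 0), the odd part of z_{-a} the one with data (0, iρ), and their sum is e_f(ρ).

By variation of constants, z_a(ρ, x) = exp(iρx) + ∫ S(x, t) exp(iρt) dt as soon as S(x, t) =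
a((x-t)/2)/2 + ∫₀ˣ a(s) S(s, x-s-t) ds for |t| < x (`goursat_eq`, `jost_eq`). The free term has only
square integrable slices, but one application of the integral operator makes it bounded by
Cauchy–Schwarz, and for the weight exp(-cx) with c large that operator halves sup norms. So S is a
convergent series, and its slices in L²(-x, x) are Lipschitz in a on bounded sets of L², uniformly
in x ≤ ℓ (`norm_remainder_sub_le`, `eLpNorm_goursat_sub_le`). K_f combines S for a and -a with their
reflections in t (`expSolution_eq`).

Uniqueness of K_f follows from Gronwall's lemma for the system (`IsExpSolution.eqOn`) and the
density of exponentials in C[-x, x] (`ae_eq_zero_of_integral_exp_eq_zero`).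

Convergence f_n' → f' in L² and the common value at 0 give f_n → f uniformly, hence f_n'/f_n → f'/f
in L² (`tendsto_logD`). The slices of K_{f_n} - K_f then tend to 0 in L²(-x, x) uniformly in x
(`exists_sliceBound_sub`). By Cauchy–Schwarz T_{f_n}u - T_f u tends to 0 uniformly on (0, ℓ), which
settles both operator statements, and integration over x gives norm, hence weak, convergence of the
kernels. That T_f preserves continuity is clear for exponentials, whose images are the e_f(ρ), and
passes to all u by density (`SliceBound.continuousOn_intOp`). -/

theorem _root_.AbsolutelyContinuousOnInterval.congr_eqOn {X : Type*} [PseudoMetricSpace X] {u v : ℝ → X}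
    {a b : ℝ} (hu : AbsolutelyContinuousOnInterval u a b) (h : EqOn u v (uIcc a b)) :
    AbsolutelyContinuousOnInterval v a b := by
  refine Tendsto.congr' ?_ hu
  filter_upwards [mem_inf_of_right (mem_principal_self _)] with E hE
  exact Finset.sum_congr rfl fun i hi => by rw [h (hE.1 i hi).1, h (hE.1 i hi).2]

theorem _root_.AbsolutelyContinuousOnInterval.of_re_im {u : ℝ → ℂ} {a b : ℝ}
    (hre : AbsolutelyContinuousOnInterval (fun x => (u x).re) a b)
    (him : AbsolutelyContinuousOnInterval (fun x => (u x).im) a b) :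
    AbsolutelyContinuousOnInterval u a b := by
  refine squeeze_zero (fun E => Finset.sum_nonneg fun i _ => dist_nonneg) (fun E => ?_)
    (by simpa using Tendsto.add hre him)
  rw [← Finset.sum_add_distrib]
  refine Finset.sum_le_sum fun i _ => ?_
  rw [dist_eq_norm, Real.dist_eq, Real.dist_eq, ← Complex.sub_re, ← Complex.sub_im]
  exact Complex.norm_le_abs_re_add_abs_im _

theorem absolutelyContinuousOnInterval_integral {v : ℝ → ℂ} {a b : ℝ}
    (hv : IntervalIntegrable v volume a b) :
    AbsolutelyContinuousOnInterval (fun x => ∫ t in a..x, v t) a b := by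
  have hsub : ∀ x ∈ uIcc a b, IntervalIntegrable v volume a x := fun x hx =>
    hv.mono_set (uIcc_subset_uIcc_left hx)
  have hre : IntervalIntegrable (fun t => (v t).re) volume a b :=
    ⟨hv.1.re, hv.2.re⟩
  have him : IntervalIntegrable (fun t => (v t).im) volume a b :=
    ⟨hv.1.im, hv.2.im⟩
  refine AbsolutelyContinuousOnInterval.of_re_im
    ((hre.absolutelyContinuousOnInterval_intervalIntegral left_mem_uIcc).congr_eqOn fun x hx => ?_)
    ((him.absolutelyContinuousOnInterval_intervalIntegral left_mem_uIcc).congr_eqOn fun x hx => ?_)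
  · exact Complex.reCLM.intervalIntegral_comp_comm (hsub x hx)
  · exact Complex.imCLM.intervalIntegral_comp_comm (hsub x hx)

theorem _root_.AbsolutelyContinuousOnInterval.ae_differentiableAt_complex {u : ℝ → ℂ} {a b : ℝ}
    (hu : AbsolutelyContinuousOnInterval u a b) :
    ∀ᵐ x, x ∈ uIcc a b → DifferentiableAt ℝ u x :=
  hu.boundedVariationOn.ae_differentiableAt_of_mem_uIcc

/-- The difference of the two sides is absolutely continuous with derivative zero almost everywhere,
hence constant. -/
theorem _root_.AbsolutelyContinuousOnInterval.eq_add_integral_deriv {u : ℝ → ℂ} {a b : ℝ}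
    (hu : AbsolutelyContinuousOnInterval u a b)
    (hi : IntervalIntegrable (deriv u) volume a b) {x : ℝ} (hx : x ∈ uIcc a b) :
    u x = u a + ∫ t in a..x, deriv u t := by
  have hac : AbsolutelyContinuousOnInterval (fun x => u x - ∫ t in a..x, deriv u t) a b :=
    hu.sub (absolutelyContinuousOnInterval_integral hi)
  obtain ⟨C, hC⟩ := hac.const_of_ae_hasDerivAt_zero (by
    filter_upwards [hu.ae_differentiableAt_complex, hi.ae_hasDerivAt_integral] with x h1 h2 h3
    have h := (h1 h3).hasDerivAt.sub (h2 h3 a left_mem_uIcc)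
    rw [sub_self] at h
    exact h)
  have h1 := hC a left_mem_uIcc
  have h2 := hC x hx
  simp only [intervalIntegral.integral_same, sub_zero] at h1
  rw [h1, ← h2]; ring

section

variable {ℓ : ℝ}

theorem ae_μ₀_iff {p : ℝ → Prop} :
    (∀ᵐ x ∂μ₀ ℓ, p x) ↔ ∀ᵐ x ∂volume.restrict (Ioc 0 ℓ), p x := by
  rw [μ₀, restrict_Ioo_eq_restrict_Ioc]

theorem ae_uIcc_to_μ₀ (hℓ : 0 ≤ ℓ) {p : ℝ → Prop} (h : ∀ᵐ x, x ∈ uIcc 0 ℓ → p x) :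
    ∀ᵐ x ∂μ₀ ℓ, p x := by
  rw [ae_restrict_iff' measurableSet_Ioo]
  filter_upwards [h] with x hx hx'
  exact hx (by rw [uIcc_of_le hℓ]; exact Ioo_subset_Icc_self hx')

theorem intervalIntegral_congr_μ₀ {u v : ℝ → ℂ} (h : u =ᵐ[μ₀ ℓ] v) {x : ℝ}
    (hx : x ∈ Icc 0 ℓ) : ∫ t in (0 : ℝ)..x, u t = ∫ t in (0 : ℝ)..x, v t := by
  rw [intervalIntegral.integral_of_le hx.1, intervalIntegral.integral_of_le hx.1]
  refine integral_congr_ae ?_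
  have := ae_μ₀_iff.1 h
  exact ae_restrict_of_ae_restrict_of_subset (Ioc_subset_Ioc_right hx.2) this

theorem MemLp.intervalIntegrable_μ₀ (hℓ : 0 ≤ ℓ) {v : ℝ → ℂ} (hv : MemLp v 2 (μ₀ ℓ)) :
    IntervalIntegrable v volume 0 ℓ := by
  rw [intervalIntegrable_iff_integrableOn_Ioo_of_le hℓ]
  exact hv.integrable one_le_two

theorem intervalIntegrable_iff_μ₀ (hℓ : 0 ≤ ℓ) {v : ℝ → ℂ} :
    IntervalIntegrable v volume 0 ℓ ↔ Integrable v (μ₀ ℓ) :=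
  intervalIntegrable_iff_integrableOn_Ioo_of_le hℓ

theorem MemW12.intervalIntegrable_deriv (hℓ : 0 ≤ ℓ) {u : ℝ → ℂ} (hu : MemW12 ℓ u) :
    IntervalIntegrable (deriv u) volume 0 ℓ :=
  MemLp.intervalIntegrable_μ₀ hℓ hu.deriv_memLp

theorem MemW12.eq_integral (hℓ : 0 ≤ ℓ) {u : ℝ → ℂ} (hu : MemW12 ℓ u) {x : ℝ}
    (hx : x ∈ Icc 0 ℓ) : u x = u 0 + ∫ t in (0 : ℝ)..x, deriv u t :=
  hu.ac.eq_add_integral_deriv (hu.intervalIntegrable_deriv hℓ) (by rwa [uIcc_of_le hℓ])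

theorem MemW12.continuousOn (hℓ : 0 ≤ ℓ) {u : ℝ → ℂ} (hu : MemW12 ℓ u) :
    ContinuousOn u (Icc 0 ℓ) := by
  simpa [uIcc_of_le hℓ] using hu.ac.continuousOn

theorem MemW12.ae_differentiableAt (hℓ : 0 ≤ ℓ) {u : ℝ → ℂ} (hu : MemW12 ℓ u) :
    ∀ᵐ x ∂μ₀ ℓ, DifferentiableAt ℝ u x :=
  ae_uIcc_to_μ₀ hℓ hu.ac.ae_differentiableAt_complex

theorem ContinuousOn.memLp_top_μ₀ {u : ℝ → ℂ} (hu : ContinuousOn u (Icc 0 ℓ)) :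
    MemLp u ⊤ (μ₀ ℓ) := by
  obtain ⟨C, hC⟩ := isCompact_Icc.exists_bound_of_continuousOn hu
  refine memLp_top_of_bound ((hu.mono Ioo_subset_Icc_self).aestronglyMeasurable
    measurableSet_Ioo) C ?_
  filter_upwards [ae_restrict_mem measurableSet_Ioo] with x hx
  exact hC x (Ioo_subset_Icc_self hx)

theorem ContinuousOn.memLp_μ₀ {u : ℝ → ℂ} (hu : ContinuousOn u (Icc 0 ℓ)) :
    MemLp u 2 (μ₀ ℓ) :=
  (ContinuousOn.memLp_top_μ₀ hu).mono_exponent le_top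

theorem MemLp.mul_continuousOn_μ₀ {u v : ℝ → ℂ} (hv : MemLp v 2 (μ₀ ℓ))
    (hu : ContinuousOn u (Icc 0 ℓ)) : MemLp (fun x => v x * u x) 2 (μ₀ ℓ) :=
  MemLp.mul' (p := 2) (q := ⊤) (r := 2) (ContinuousOn.memLp_top_μ₀ hu) hv

theorem MemLp.integrable_mul_μ₀ {u v : ℝ → ℂ} (hu : MemLp u 2 (μ₀ ℓ)) (hv : MemLp v 2 (μ₀ ℓ)) :
    Integrable (fun x => u x * v x) (μ₀ ℓ) :=
  MemLp.integrable_mul hu hv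

/-- Indefinite integrals of square integrable functions belong to `W^{1,2}`. -/
theorem memW12_of_eq_integral (hℓ : 0 ≤ ℓ) {u v : ℝ → ℂ} (hv : MemLp v 2 (μ₀ ℓ)) (c : ℂ)
    (h : ∀ x ∈ Icc 0 ℓ, u x = c + ∫ t in (0 : ℝ)..x, v t) :
    MemW12 ℓ u ∧ deriv u =ᵐ[μ₀ ℓ] v := by
  have hi := MemLp.intervalIntegrable_μ₀ hℓ hv
  have hd : deriv u =ᵐ[μ₀ ℓ] v := by
    have hI := ae_uIcc_to_μ₀ hℓ
      (hi.ae_hasDerivAt_integral.mono fun x hx hx' => hx hx' 0 left_mem_uIcc)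
    filter_upwards [hI, ae_restrict_mem measurableSet_Ioo] with x hx hx'
    refine HasDerivAt.deriv ((hx.const_add c).congr_of_eventuallyEq ?_)
    filter_upwards [Ioo_mem_nhds hx'.1 hx'.2] with y hy
    exact h y (Ioo_subset_Icc_self hy)
  have hconst : AbsolutelyContinuousOnInterval (fun _ : ℝ => c) 0 ℓ :=
    (contDiff_const.contDiffOn).absolutelyContinuousOnInterval
  refine ⟨⟨?_, (memLp_congr_ae hd).2 hv⟩, hd⟩
  refine (hconst.add (absolutelyContinuousOnInterval_integral hi)).congr_eqOn fun x hx => ?_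
  rw [uIcc_of_le hℓ] at hx
  exact (h x hx).symm

theorem MemW12.add (hℓ : 0 ≤ ℓ) {u v : ℝ → ℂ} (hu : MemW12 ℓ u) (hv : MemW12 ℓ v) :
    MemW12 ℓ (fun x => u x + v x) ∧
      deriv (fun x => u x + v x) =ᵐ[μ₀ ℓ] fun x => deriv u x + deriv v x := by
  have hd : deriv (fun x => u x + v x) =ᵐ[μ₀ ℓ] fun x => deriv u x + deriv v x := by
    filter_upwards [hu.ae_differentiableAt hℓ, hv.ae_differentiableAt hℓ] with x h1 h2
    exact (h1.hasDerivAt.add h2.hasDerivAt).deriv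
  exact ⟨⟨hu.ac.add hv.ac, (memLp_congr_ae hd).2 (hu.deriv_memLp.add hv.deriv_memLp)⟩, hd⟩

theorem MemW12.const_mul {u : ℝ → ℂ} (hu : MemW12 ℓ u) (c : ℂ) :
    MemW12 ℓ (fun x => c * u x) ∧ ∀ x, deriv (fun x => c * u x) x = c * deriv u x := by
  have hd : deriv (fun x => c * u x) = fun x => c * deriv u x := by
    funext x; exact deriv_const_mul_field c
  exact ⟨⟨hu.ac.const_smul c, hd ▸ hu.deriv_memLp.const_mul c⟩, fun x => congrFun hd x⟩

theorem MemW12.mul (hℓ : 0 ≤ ℓ) {u v : ℝ → ℂ} (hu : MemW12 ℓ u) (hv : MemW12 ℓ v) :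
    MemW12 ℓ (fun x => u x * v x) ∧
      deriv (fun x => u x * v x) =ᵐ[μ₀ ℓ] fun x => deriv u x * v x + u x * deriv v x := by
  have hd : deriv (fun x => u x * v x) =ᵐ[μ₀ ℓ] fun x => deriv u x * v x + u x * deriv v x := by
    filter_upwards [hu.ae_differentiableAt hℓ, hv.ae_differentiableAt hℓ] with x h1 h2
    exact (h1.hasDerivAt.mul h2.hasDerivAt).deriv
  refine ⟨⟨hu.ac.smul hv.ac, (memLp_congr_ae hd).2 ?_⟩, hd⟩
  refine (MemLp.mul_continuousOn_μ₀ hu.deriv_memLp (hv.continuousOn hℓ)).add ?_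
  simpa only [mul_comm] using MemLp.mul_continuousOn_μ₀ hv.deriv_memLp (hu.continuousOn hℓ)

theorem MemW12.integral_mul_deriv (hℓ : 0 ≤ ℓ) {u v : ℝ → ℂ} (hu : MemW12 ℓ u)
    (hv : MemW12Zero ℓ v) :
    ∫ x in (0 : ℝ)..ℓ, u x * deriv v x = -∫ x in (0 : ℝ)..ℓ, deriv u x * v x := by
  obtain ⟨hm, hd⟩ := hu.mul hℓ hv.memW12
  have h1 := hm.eq_integral hℓ (right_mem_Icc.2 hℓ)
  rw [intervalIntegral_congr_μ₀ hd (right_mem_Icc.2 hℓ), hv.left, hv.right,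
    intervalIntegral.integral_add] at h1
  · linear_combination -h1
  · exact (hu.intervalIntegrable_deriv hℓ).mul_continuousOn
      (by simpa [uIcc_of_le hℓ] using hv.memW12.continuousOn hℓ)
  · exact (hv.memW12.intervalIntegrable_deriv hℓ).continuousOn_mul
      (by simpa [uIcc_of_le hℓ] using hu.continuousOn hℓ)

theorem memW12_of_contDiff {u : ℝ → ℂ} (hu : ContDiff ℝ ∞ u) : MemW12 ℓ u :=
  ⟨(hu.of_le (by norm_num)).contDiffOn.absolutelyContinuousOnInterval,
    ContinuousOn.memLp_μ₀ (hu.continuous_deriv (by norm_num)).continuousOn⟩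

end

end Transmutation
end

noncomputable section
namespace Transmutation

/-! ### A weighted Volterra estimate -/

/-- The norm of `L²` as a real number. -/
abbrev norm₂ {α E : Type*} [MeasurableSpace α] [NormedAddCommGroup E] (u : α → E)
    (μ : Measure α) : ℝ := (eLpNorm u 2 μ).toReal

theorem norm₂_eq_sqrt {α E : Type*} [MeasurableSpace α] [NormedAddCommGroup E] {μ : Measure α}
    {u : α → E} (hu : MemLp u 2 μ) : norm₂ u μ = √(∫ x, ‖u x‖ ^ 2 ∂μ) := by
  rw [norm₂, hu.eLpNorm_eq_integral_rpow_norm two_ne_zero ENNReal.ofNat_ne_top,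
    ENNReal.toReal_ofReal (by positivity), Real.sqrt_eq_rpow]
  simp

theorem integral_norm_mul_norm_le {α E F : Type*} [MeasurableSpace α] [NormedAddCommGroup E]
    [NormedAddCommGroup F] {μ : Measure α} {u : α → E} {v : α → F} (hu : MemLp u 2 μ)
    (hv : MemLp v 2 μ) : ∫ x, ‖u x‖ * ‖v x‖ ∂μ ≤ norm₂ u μ * norm₂ v μ := by
  have h := integral_mul_norm_le_Lp_mul_Lq (μ := μ) (f := fun x => ‖u x‖) (g := fun x => ‖v x‖)
    (Real.HolderConjugate.two_two) (by simpa using hu.norm) (by simpa using hv.norm)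
  rw [norm₂_eq_sqrt hu, norm₂_eq_sqrt hv, Real.sqrt_eq_rpow, Real.sqrt_eq_rpow]
  simpa using h

/-- Cauchy–Schwarz together with ∫₀ˣ exp(2cs) ds ≤ exp(2cx)/(2c). The factor 1/√(2c) is what makes
Volterra operators small when c is large. -/
theorem integral_norm_mul_exp_le {a : ℝ → ℂ} (ha : MemLp a 2 volume) {c : ℝ} (hc : 0 < c)
    (x : ℝ) : IntegrableOn (fun s => ‖a s‖ * Real.exp (c * s)) (Ioc 0 x) ∧
    ∫ s in Ioc 0 x, ‖a s‖ * Real.exp (c * s) ≤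
      norm₂ a volume / √(2 * c) * Real.exp (c * x) := by
  have hexp : MemLp (fun s => Real.exp (c * s)) 2 (volume.restrict (Ioc 0 x)) := by
    refine MemLp.mono_exponent (q := ⊤) ?_ le_top
    refine memLp_top_of_bound (by fun_prop) (Real.exp (c * x)) ?_
    filter_upwards [ae_restrict_mem measurableSet_Ioc] with s hs
    rw [Real.norm_eq_abs, abs_of_pos (Real.exp_pos _)]
    exact Real.exp_le_exp.2 (by nlinarith [hs.2])
  have ha' : MemLp a 2 (volume.restrict (Ioc 0 x)) := ha.restrict _
  refine ⟨MemLp.integrable_mul ha'.norm hexp, ?_⟩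
  have h := integral_norm_mul_norm_le ha' hexp
  simp only [Real.norm_eq_abs, Real.abs_exp] at h
  refine h.trans ?_
  have h1 : norm₂ a (volume.restrict (Ioc 0 x)) ≤ norm₂ a volume :=
    ENNReal.toReal_mono ha.eLpNorm_ne_top (eLpNorm_restrict_le _ _ _ _)
  have h2 : norm₂ (fun s => Real.exp (c * s)) (volume.restrict (Ioc 0 x)) ≤
      Real.exp (c * x) / √(2 * c) := by
    rw [norm₂_eq_sqrt hexp, Real.sqrt_le_left (by positivity), div_pow,
      Real.sq_sqrt (by positivity)]
    simp only [Real.norm_eq_abs, Real.abs_exp, ← Real.exp_nat_mul]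
    rcases le_or_gt x 0 with hx | hx
    · rw [Ioc_eq_empty (not_lt.2 hx)]; simp; positivity
    · rw [← intervalIntegral.integral_of_le hx.le]
      have h3 : ∫ s in (0 : ℝ)..x, Real.exp (((2 : ℕ) : ℝ) * (c * s)) =
          (Real.exp ((2 * c) * x) - 1) / (2 * c) := by
        rw [intervalIntegral.integral_congr (g := fun s => Real.exp ((2 * c) * s))
          (fun s _ => by push_cast; ring_nf), intervalIntegral.integral_comp_mul_left
          (fun s => Real.exp s) (by positivity), integral_exp]
        simp [div_eq_inv_mul]
      rw [h3]
      gcongr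
      have : ((2 : ℕ) : ℝ) * (c * x) = 2 * c * x := by push_cast; ring
      rw [this]; linarith
  calc _ ≤ norm₂ a volume * (Real.exp (c * x) / √(2 * c)) := by
        gcongr
    _ = _ := by ring

/-- The Volterra operator with coefficient `a ∈ L²` has small norm with respect to the weight
`exp (-c x)`. -/
theorem integral_norm_mul_le {a : ℝ → ℂ} (ha : MemLp a 2 volume) {c : ℝ} (hc : 0 < c)
    {x M : ℝ} (hM : 0 ≤ M) {N : ℝ → ℝ} (hN0 : ∀ s, 0 ≤ N s)
    (hN : ∀ s ∈ Ioc 0 x, N s ≤ M * Real.exp (c * s)) :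
    ∫ s in Ioc 0 x, ‖a s‖ * N s ≤ norm₂ a volume / √(2 * c) * M * Real.exp (c * x) := by
  obtain ⟨hi, hle⟩ := integral_norm_mul_exp_le ha hc x
  calc ∫ s in Ioc 0 x, ‖a s‖ * N s
      ≤ ∫ s in Ioc 0 x, M * (‖a s‖ * Real.exp (c * s)) := by
        refine integral_mono_of_nonneg (ae_of_all _ fun s => mul_nonneg (norm_nonneg _) (hN0 s))
          (hi.const_mul M) ?_
        filter_upwards [ae_restrict_mem measurableSet_Ioc] with s hs
        nlinarith [hN s hs, norm_nonneg (a s)]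
    _ ≤ M * (norm₂ a volume / √(2 * c) * Real.exp (c * x)) := by
        rw [integral_const_mul]; gcongr
    _ = _ := by ring

/-- An exponent for which Volterra operators with coefficients of norm at most `Λ` are
contractions. -/
def rate (Λ : ℝ) : ℝ := 2 * Λ ^ 2 + 1

theorem rate_pos (Λ : ℝ) : 0 < rate Λ := by unfold rate; positivity

/-- Here 2c = 4Λ² + 2 ≥ (2Λ)². The summand 1 in the rate keeps c positive when Λ = 0. -/
theorem div_sqrt_rate_le {Λ r : ℝ} (hr : r ≤ Λ) : r / √(2 * rate Λ) ≤ 1 / 2 := by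
  have h : 2 * Λ ≤ √(2 * rate Λ) := Real.le_sqrt_of_sq_le (by unfold rate; nlinarith)
  have h0 : 0 < √(2 * rate Λ) := Real.sqrt_pos.2 (by have := rate_pos Λ; positivity)
  rw [div_le_iff₀ h0]; linarith

theorem integral_norm_mul_le_half {a : ℝ → ℂ} (ha : MemLp a 2 volume) {Λ : ℝ}
    (hΛ : norm₂ a volume ≤ Λ) {x M : ℝ} (hM : 0 ≤ M) {N : ℝ → ℝ} (hN0 : ∀ s, 0 ≤ N s)
    (hN : ∀ s ∈ Ioc 0 x, N s ≤ M * Real.exp (rate Λ * s)) :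
    ∫ s in Ioc 0 x, ‖a s‖ * N s ≤ M / 2 * Real.exp (rate Λ * x) := by
  refine (integral_norm_mul_le ha (rate_pos Λ) hM hN0 hN).trans ?_
  have h := div_sqrt_rate_le hΛ
  gcongr
  nlinarith

theorem le_zero_of_forall_le_div_two_pow {r M : ℝ} (h : ∀ n : ℕ, r ≤ M / 2 ^ n) : r ≤ 0 := by
  have ht : Tendsto (fun n : ℕ => M / 2 ^ n) atTop (𝓝 0) := by
    have := (tendsto_pow_atTop_nhds_zero_of_lt_one (r := (1 / 2 : ℝ)) (by norm_num)
      (by norm_num)).const_mul M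
    simpa [div_eq_mul_inv] using this
  exact ge_of_tendsto' ht h

/-- A Gronwall lemma with a square integrable coefficient. -/
theorem eq_zero_of_le_integral_mul {k : ℝ → ℂ} (hk : MemLp k 2 volume) {ℓ M : ℝ} {N : ℝ → ℝ}
    (hN0 : ∀ s, 0 ≤ N s) (hM : ∀ x ∈ Icc 0 ℓ, N x ≤ M)
    (h : ∀ x ∈ Icc 0 ℓ, N x ≤ ∫ s in Ioc 0 x, ‖k s‖ * N s) : ∀ x ∈ Icc 0 ℓ, N x = 0 := by
  intro x₀ hx₀
  have hM0 : 0 ≤ M := (hN0 _).trans (hM _ hx₀)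
  -- Each substitution of the bound into the integral inequality halves its constant.
  have key : ∀ n : ℕ, ∀ x ∈ Icc 0 ℓ,
      N x ≤ M / 2 ^ n * Real.exp (rate (norm₂ k volume) * x) := by
    intro n
    induction n with
    | zero =>
      intro x hx
      have : 1 ≤ Real.exp (rate (norm₂ k volume) * x) :=
        Real.one_le_exp (mul_nonneg (rate_pos _).le hx.1)
      have := hM x hx
      simp only [pow_zero, div_one]
      nlinarith
    | succ n ih =>
      intro x hx
      refine (h x hx).trans ((integral_norm_mul_le_half hk le_rfl (by positivity) hN0
        fun s hs => ih s ⟨hs.1.le, hs.2.trans hx.2⟩).trans_eq ?_)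
      rw [pow_succ]; ring
  refine le_antisymm (le_zero_of_forall_le_div_two_pow
    (M := M * Real.exp (rate (norm₂ k volume) * x₀)) fun n => ?_) (hN0 _)
  exact (key n x₀ hx₀).trans_eq (by ring)

end Transmutation
end

noncomputable section
namespace Transmutation

/-! ### The Volterra series of the Goursat problem -/

/-- A square integrable, strongly measurable coefficient. -/
structure IsCoeff (a : ℝ → ℂ) : Prop where
  meas : StronglyMeasurable a
  memLp : MemLp a 2 volume

theorem IsCoeff.neg {a : ℝ → ℂ} (ha : IsCoeff a) : IsCoeff (-a) := ⟨ha.meas.neg, ha.memLp.neg⟩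

theorem IsCoeff.sub {a a' : ℝ → ℂ} (ha : IsCoeff a) (ha' : IsCoeff a') : IsCoeff (a - a') :=
  ⟨ha.meas.sub ha'.meas, ha.memLp.sub ha'.memLp⟩

theorem isCoeff_zero : IsCoeff 0 := ⟨stronglyMeasurable_zero, MemLp.zero⟩

/-- The Volterra operator along characteristics. -/
def volterra (a : ℝ → ℂ) (φ : ℝ → ℝ → ℂ) (x t : ℝ) : ℂ :=
  ∫ s in Ioc 0 x, a s * φ s (x - s - t)

/-- The first iterate. -/
def seed (a : ℝ → ℂ) (x t : ℝ) : ℂ := if |t| < x then a ((x - t) / 2) / 2 else 0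

/-- The iterated integrals. -/
def iterate (a : ℝ → ℂ) : ℕ → ℝ → ℝ → ℂ
  | 0 => volterra a (seed a)
  | n + 1 => volterra a (iterate a n)

/-- The bounded part of the solution. -/
def remainder (a : ℝ → ℂ) (x t : ℝ) : ℂ := ∑' n, iterate a n x t

/-- The solution of `S = seed a + volterra a S`. -/
def goursat (a : ℝ → ℂ) (x t : ℝ) : ℂ := seed a x t + remainder a x t

variable {a a' : ℝ → ℂ} {φ ψ : ℝ → ℝ → ℂ}

theorem stronglyMeasurable_volterra (ha : StronglyMeasurable a)
    (hφ : StronglyMeasurable (Function.uncurry φ)) :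
    StronglyMeasurable (Function.uncurry (volterra a φ)) := by
  have h : Function.uncurry (volterra a φ) = fun p : ℝ × ℝ =>
      ∫ s, {q : (ℝ × ℝ) × ℝ | 0 < q.2 ∧ q.2 ≤ q.1.1}.indicator
        (fun q => a q.2 * Function.uncurry φ (q.2, q.1.1 - q.2 - q.1.2)) (p, s) := by
    funext ⟨x, t⟩
    simp only [Function.uncurry, volterra]
    rw [← integral_indicator measurableSet_Ioc]
    rfl
  rw [h]
  refine StronglyMeasurable.integral_prod_right ?_
  refine StronglyMeasurable.indicator ?_ ?_
  · exact (ha.comp_measurable measurable_snd).mul (hφ.comp_measurable (by fun_prop))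
  · exact (measurableSet_lt measurable_const measurable_snd).inter
      (measurableSet_le measurable_snd (by fun_prop))

theorem stronglyMeasurable_seed (ha : StronglyMeasurable a) :
    StronglyMeasurable (Function.uncurry (seed a)) := by
  have h : Function.uncurry (seed a) = {p : ℝ × ℝ | |p.2| < p.1}.indicator
      (fun p => a ((p.1 - p.2) / 2) / 2) := by
    funext ⟨x, t⟩
    simp [Function.uncurry, seed, indicator_apply]
  rw [h]
  refine StronglyMeasurable.indicator ?_ ?_
  · have := (ha.comp_measurable
      (show Measurable fun p : ℝ × ℝ => (p.1 - p.2) / 2 by fun_prop)).mul_const (1 / 2)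
    simpa [div_eq_mul_inv] using this
  · exact measurableSet_lt (by fun_prop) (by fun_prop)

theorem stronglyMeasurable_iterate (ha : StronglyMeasurable a) (n : ℕ) :
    StronglyMeasurable (Function.uncurry (iterate a n)) := by
  induction n with
  | zero => exact stronglyMeasurable_volterra ha (stronglyMeasurable_seed ha)
  | succ n ih => exact stronglyMeasurable_volterra ha ih

/-- Support in |t| < x is preserved: if 0 < s ≤ x and |x-s-t| < s, then x-2s < t < x, so |t| < x. -/
theorem volterra_eq_zero (hφ : ∀ x t, x ≤ |t| → φ x t = 0) (x t : ℝ) (h : x ≤ |t|) :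
    volterra a φ x t = 0 := by
  refine setIntegral_eq_zero_of_forall_eq_zero fun s hs => ?_
  rw [hφ s _, mul_zero]
  by_contra! hlt
  rw [abs_lt] at hlt
  rcases le_abs.1 h with h | h <;> linarith [hs.1, hs.2]

theorem seed_eq_zero (x t : ℝ) (h : x ≤ |t|) : seed a x t = 0 := if_neg (not_lt.2 h)

theorem iterate_eq_zero (n : ℕ) : ∀ x t, x ≤ |t| → iterate a n x t = 0 := by
  induction n with
  | zero => exact volterra_eq_zero seed_eq_zero
  | succ n ih => exact volterra_eq_zero ih

theorem remainder_eq_zero (x t : ℝ) (h : x ≤ |t|) : remainder a x t = 0 := by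
  simp [remainder, iterate_eq_zero _ x t h]

theorem goursat_eq_zero (x t : ℝ) (h : x ≤ |t|) : goursat a x t = 0 := by
  rw [goursat, seed_eq_zero x t h, remainder_eq_zero x t h, add_zero]

theorem norm_volterra_le (a : ℝ → ℂ) (φ : ℝ → ℝ → ℂ) (x t : ℝ) :
    ‖volterra a φ x t‖ ≤ ∫ s in Ioc 0 x, ‖a s‖ * ‖φ s (x - s - t)‖ :=
  (norm_integral_le_integral_norm _).trans_eq (by simp_rw [norm_mul])

theorem norm_volterra_le_half (ha : IsCoeff a) {Λ M : ℝ} (hΛ : norm₂ a volume ≤ Λ) (hM : 0 ≤ M)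
    (hφ : ∀ x t, ‖φ x t‖ ≤ M * Real.exp (rate Λ * x)) (x t : ℝ) :
    ‖volterra a φ x t‖ ≤ M / 2 * Real.exp (rate Λ * x) :=
  (norm_volterra_le _ _ _ _).trans <|
    integral_norm_mul_le_half ha.memLp hΛ hM (fun _ => norm_nonneg _) fun s _ => hφ s _

/-- A variant that keeps the norm of the coefficient as a factor. It serves for the coefficient a -
a', where smallness of the norm matters rather than contraction. -/
theorem norm_volterra_le_norm₂ (ha : IsCoeff a) {Λ M : ℝ} (hM : 0 ≤ M)
    (hφ : ∀ x t, ‖φ x t‖ ≤ M * Real.exp (rate Λ * x)) (x t : ℝ) :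
    ‖volterra a φ x t‖ ≤ norm₂ a volume * M * Real.exp (rate Λ * x) := by
  refine (norm_volterra_le _ _ _ _).trans <|
    (integral_norm_mul_le ha.memLp (rate_pos Λ) hM (fun _ => norm_nonneg _)
      fun s _ => hφ s _).trans ?_
  have h : 1 ≤ √(2 * rate Λ) := Real.le_sqrt_of_sq_le (by unfold rate; nlinarith [sq_nonneg Λ])
  gcongr
  exact div_le_self ENNReal.toReal_nonneg h

theorem memLp_translate (ha : IsCoeff a) (y : ℝ) : MemLp (fun s => a (s - y)) 2 volume ∧
    norm₂ (fun s => a (s - y)) volume = norm₂ a volume := by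
  have hmp := measurePreserving_sub_right volume y
  exact ⟨ha.memLp.comp_measurePreserving hmp, by
    rw [norm₂, norm₂, ← eLpNorm_comp_measurePreserving ha.memLp.1 hmp]; rfl⟩

/-- Along the characteristic t ↦ x-s-t the free term is, as a function of s, a truncated translate
of a by (x-t)/2. -/
theorem norm_seed_le (s x t : ℝ) : ‖seed a s (x - s - t)‖ ≤ ‖a (s - (x - t) / 2)‖ / 2 := by
  unfold seed
  split_ifs
  · rw [show (s - (x - s - t)) / 2 = s - (x - t) / 2 by ring]; simp
  · rw [norm_zero]; positivity

/-- Cauchy–Schwarz for a and a translate of a' gives a bound at every point, although the free term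
itself need not be bounded. -/
theorem norm_volterra_seed_le (ha : IsCoeff a) (ha' : IsCoeff a') {c : ℝ} (hc : 0 ≤ c) (x t : ℝ) :
    ‖volterra a (seed a') x t‖ ≤
      norm₂ a volume * norm₂ a' volume / 2 * Real.exp (c * x) := by
  rcases le_or_gt x 0 with hx | hx
  · rw [volterra_eq_zero seed_eq_zero x t (hx.trans (abs_nonneg t)), norm_zero]; positivity
  have h1 : norm₂ a volume * norm₂ a' volume / 2 ≤
      norm₂ a volume * norm₂ a' volume / 2 * Real.exp (c * x) :=
    le_mul_of_one_le_right (by positivity) (Real.one_le_exp (by positivity))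
  obtain ⟨hT, hN⟩ := memLp_translate ha' ((x - t) / 2)
  have hi := MemLp.integrable_mul ha.memLp.norm hT.norm
  refine (norm_volterra_le _ _ _ _).trans (le_trans ?_ h1)
  calc ∫ s in Ioc 0 x, ‖a s‖ * ‖seed a' s (x - s - t)‖
      ≤ ∫ s in Ioc 0 x, ‖a s‖ * ‖a' (s - (x - t) / 2)‖ / 2 := by
        refine integral_mono_of_nonneg (ae_of_all _ fun s => by positivity)
          (hi.integrableOn.div_const 2) (ae_of_all _ fun s => ?_)
        have := norm_seed_le (a := a') s x t
        dsimp only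
        nlinarith [norm_nonneg (a s)]
    _ ≤ ∫ s, ‖a s‖ * ‖a' (s - (x - t) / 2)‖ / 2 :=
        setIntegral_le_integral (hi.div_const 2) (ae_of_all _ fun s => by positivity)
    _ ≤ _ := by
        rw [integral_div, ← hN]
        gcongr
        exact integral_norm_mul_norm_le ha.memLp hT

/-- The constant Λ²/2/2ⁿ is arranged so that the geometric series sums to Λ². -/
theorem norm_iterate_le (ha : IsCoeff a) {Λ : ℝ} (hΛ : norm₂ a volume ≤ Λ) (n : ℕ) :
    ∀ x t, ‖iterate a n x t‖ ≤ Λ ^ 2 / 2 / 2 ^ n * Real.exp (rate Λ * x) := by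
  induction n with
  | zero =>
    intro x t
    refine (norm_volterra_seed_le ha ha (rate_pos Λ).le x t).trans ?_
    have h0 : 0 ≤ Λ := ENNReal.toReal_nonneg.trans hΛ
    simp only [pow_zero, div_one, sq]
    gcongr
  | succ n ih =>
    intro x t
    refine (norm_volterra_le_half ha hΛ (by positivity) ih x t).trans_eq ?_
    rw [pow_succ]; ring

theorem hasSum_iterate (ha : IsCoeff a) (x t : ℝ) :
    HasSum (fun n => iterate a n x t) (remainder a x t) := by
  refine (Summable.of_norm_bounded ?_ fun n => norm_iterate_le ha le_rfl n x t).hasSum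
  exact ((hasSum_geometric_two' _).mul_right _).summable

theorem norm_remainder_le (ha : IsCoeff a) {Λ : ℝ} (hΛ : norm₂ a volume ≤ Λ) (x t : ℝ) :
    ‖remainder a x t‖ ≤ Λ ^ 2 * Real.exp (rate Λ * x) :=
  tsum_of_norm_bounded ((hasSum_geometric_two' _).mul_right _)
    fun n => norm_iterate_le ha hΛ n x t

theorem stronglyMeasurable_remainder (ha : IsCoeff a) :
    StronglyMeasurable (Function.uncurry (remainder a)) := by
  refine stronglyMeasurable_of_tendsto (f := fun n (p : ℝ × ℝ) =>
    ∑ i ∈ Finset.range n, iterate a i p.1 p.2) atTop (fun n => ?_) ?_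
  · exact Finset.stronglyMeasurable_fun_sum _ fun i _ => stronglyMeasurable_iterate ha.meas i
  · rw [tendsto_pi_nhds]
    exact fun p => (hasSum_iterate ha p.1 p.2).tendsto_sum_nat

theorem stronglyMeasurable_goursat (ha : IsCoeff a) :
    StronglyMeasurable (Function.uncurry (goursat a)) :=
  (stronglyMeasurable_seed ha.meas).add (stronglyMeasurable_remainder ha)

theorem integrableOn_mul_seed (ha : IsCoeff a) (ha' : IsCoeff a') (x t : ℝ) :
    IntegrableOn (fun s => a s * seed a' s (x - s - t)) (Ioc 0 x) := by
  obtain ⟨hT, -⟩ := memLp_translate ha' ((x - t) / 2)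
  refine Integrable.mono ((MemLp.integrable_mul ha.memLp.norm hT.norm).integrableOn) ?_
    (ae_of_all _ fun s => ?_)
  · exact (ha.meas.mul ((stronglyMeasurable_seed ha'.meas).comp_measurable
      (show Measurable fun s : ℝ => (s, x - s - t) by fun_prop))).aestronglyMeasurable
  · simp only [norm_mul, Pi.mul_apply, norm_norm]
    have := norm_seed_le (a := a') s x t
    gcongr
    linarith [norm_nonneg (a' (s - (x - t) / 2))]

theorem integrableOn_mul_of_bound (ha : IsCoeff a)
    (hφ : StronglyMeasurable (Function.uncurry φ)) {c M : ℝ} (hc : 0 < c)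
    (hM : ∀ x t, ‖φ x t‖ ≤ M * Real.exp (c * x)) (x t : ℝ) :
    IntegrableOn (fun s => a s * φ s (x - s - t)) (Ioc 0 x) := by
  refine Integrable.mono' ((integral_norm_mul_exp_le ha.memLp hc x).1.const_mul M) ?_
    (ae_of_all _ fun s => ?_)
  · exact (ha.meas.mul (hφ.comp_measurable
      (show Measurable fun s : ℝ => (s, x - s - t) by fun_prop))).aestronglyMeasurable
  · rw [norm_mul]
    nlinarith [hM s (x - s - t), norm_nonneg (a s)]

/-- Split off the term n = 0 and apply the Volterra operator termwise to the rest; the geometric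
bounds on the iterates justify dominated convergence. -/
theorem remainder_eq (ha : IsCoeff a) (x t : ℝ) :
    remainder a x t = volterra a (seed a) x t + volterra a (remainder a) x t := by
  have h1 : HasSum (fun n => iterate a (n + 1) x t) (volterra a (remainder a) x t) := by
    refine hasSum_integral_of_dominated_convergence
      (bound := fun n s => ‖a s‖ * (norm₂ a volume ^ 2 / 2 / 2 ^ n *
        Real.exp (rate (norm₂ a volume) * s))) (fun n => ?_) (fun n => ae_of_all _ fun s => ?_)
      (ae_of_all _ fun s => ?_) ?_ (ae_of_all _ fun s => ?_)
    · exact (integrableOn_mul_of_bound ha (stronglyMeasurable_iterate ha.meas n) (rate_pos _)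
        (norm_iterate_le ha le_rfl n) x t).1
    · rw [norm_mul]
      gcongr
      exact norm_iterate_le ha le_rfl n _ _
    · exact (((hasSum_geometric_two' _).mul_right _).mul_left _).summable
    · simp_rw [fun s => (((hasSum_geometric_two' (norm₂ a volume ^ 2)).mul_right
        (Real.exp (rate (norm₂ a volume) * s))).mul_left ‖a s‖).tsum_eq]
      refine ((integral_norm_mul_exp_le ha.memLp (rate_pos (norm₂ a volume)) x).1.const_mul
        (norm₂ a volume ^ 2)).congr (ae_of_all _ fun s => ?_)
      dsimp only; ring
    · exact (hasSum_iterate ha s (x - s - t)).mul_left (a s)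
  have h2 := (hasSum_iterate ha x t).summable.hasSum_iff.1 (hasSum_iterate ha x t)
  rw [← h2, (hasSum_iterate ha x t).summable.tsum_eq_zero_add, h1.tsum_eq]
  rfl

theorem goursat_eq (ha : IsCoeff a) (x t : ℝ) :
    goursat a x t = seed a x t + volterra a (goursat a) x t := by
  rw [goursat, remainder_eq ha, volterra, volterra, ← integral_add]
  · simp only [volterra, goursat, mul_add]
  · exact integrableOn_mul_seed ha ha x t
  · exact integrableOn_mul_of_bound ha (stronglyMeasurable_remainder ha) (rate_pos _)
      (norm_remainder_le ha le_rfl) x t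

/-- The difference of the remainders solves a Volterra equation with coefficient a whose forcing is
linear in a - a' and bounded by B exp(cx), c the rate for Λ. Contraction by 1/2 then bounds the
solution by 2B exp(cx). -/
theorem norm_remainder_sub_le (ha : IsCoeff a) (ha' : IsCoeff a') {Λ : ℝ}
    (hΛ : norm₂ a volume ≤ Λ) (hΛ' : norm₂ a' volume ≤ Λ) (x t : ℝ) :
    ‖remainder a x t - remainder a' x t‖ ≤
      2 * ((Λ + Λ ^ 2) * norm₂ (a - a') volume) * Real.exp (rate Λ * x) := by
  set B := (Λ + Λ ^ 2) * norm₂ (a - a') volume with hB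
  have hΛ0 : 0 ≤ Λ := ENNReal.toReal_nonneg.trans hΛ
  have hB0 : 0 ≤ B := by positivity
  have hdiff := ha.sub ha'
  have hmR := stronglyMeasurable_remainder ha
  have hmR' := stronglyMeasurable_remainder ha'
  have hbR := norm_remainder_le ha hΛ
  have hbR' := norm_remainder_le ha' hΛ'
  have hid : ∀ x t, remainder a x t - remainder a' x t =
      volterra (a - a') (seed a) x t + volterra a' (seed (a - a')) x t
      + (volterra a (fun x t => remainder a x t - remainder a' x t) x t
      + volterra (a - a') (remainder a') x t) := by
    intro x t
    have e1 : volterra (a - a') (seed a) x t + volterra a' (seed (a - a')) x t =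
        volterra a (seed a) x t - volterra a' (seed a') x t := by
      unfold volterra
      rw [← integral_add (integrableOn_mul_seed hdiff ha x t)
        (integrableOn_mul_seed ha' hdiff x t), ← integral_sub (integrableOn_mul_seed ha ha x t)
        (integrableOn_mul_seed ha' ha' x t)]
      congr 1 with s
      simp only [seed, Pi.sub_apply]
      split_ifs <;> ring
    have e2 : volterra a (fun x t => remainder a x t - remainder a' x t) x t
        + volterra (a - a') (remainder a') x t =
        volterra a (remainder a) x t - volterra a' (remainder a') x t := by
      unfold volterra
      rw [← integral_add (integrableOn_mul_of_bound (M := Λ ^ 2 + Λ ^ 2)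
        (φ := fun x t => remainder a x t - remainder a' x t) ha (hmR.sub hmR')
        (rate_pos Λ) (fun x t => ?_) x t)
        (integrableOn_mul_of_bound hdiff hmR' (rate_pos Λ) hbR' x t),
        ← integral_sub (integrableOn_mul_of_bound ha hmR (rate_pos Λ) hbR x t)
        (integrableOn_mul_of_bound ha' hmR' (rate_pos Λ) hbR' x t)]
      · refine integral_congr_ae (ae_of_all _ fun s => ?_)
        simp only [Pi.sub_apply]
        ring
      · rw [add_mul]
        exact (norm_sub_le _ _).trans (add_le_add (hbR x t) (hbR' x t))
    rw [e1, e2, remainder_eq ha, remainder_eq ha']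
    ring
  -- Iteration of M ↦ B + M/2, whose fixed point is 2B, starting from the crude bound 2Λ² for the
  -- two remainders.
  have key : ∀ n : ℕ, ∀ x t, ‖remainder a x t - remainder a' x t‖ ≤
      (2 * B + 2 * Λ ^ 2 / 2 ^ n) * Real.exp (rate Λ * x) := by
    intro n
    induction n with
    | zero =>
      intro x t
      refine ((norm_sub_le _ _).trans (add_le_add (hbR x t) (hbR' x t))).trans ?_
      rw [← add_mul]
      refine mul_le_mul_of_nonneg_right ?_ (Real.exp_pos _).le
      rw [pow_zero, div_one]
      linarith
    | succ n ih =>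
      intro x t
      rw [hid x t]
      have b1 := norm_volterra_seed_le hdiff ha (rate_pos Λ).le x t
      have b2 := norm_volterra_seed_le ha' hdiff (rate_pos Λ).le x t
      have b3 := norm_volterra_le_half ha hΛ (by positivity) ih x t
      have b4 := norm_volterra_le_norm₂ hdiff (by positivity) hbR' x t
      have hn : 0 ≤ norm₂ (a - a') volume := ENNReal.toReal_nonneg
      calc _ ≤ _ := (norm_add_le _ _).trans (add_le_add (norm_add_le _ _) (norm_add_le _ _))
        _ ≤ _ := add_le_add (add_le_add b1 b2) (add_le_add b3 b4)
        _ ≤ norm₂ (a - a') volume * Λ / 2 * Real.exp (rate Λ * x) +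
            Λ * norm₂ (a - a') volume / 2 * Real.exp (rate Λ * x) +
            ((2 * B + 2 * Λ ^ 2 / 2 ^ n) / 2 * Real.exp (rate Λ * x) +
            norm₂ (a - a') volume * Λ ^ 2 * Real.exp (rate Λ * x)) := by gcongr
        _ = _ := by rw [hB, pow_succ]; ring
  have hlim := le_zero_of_forall_le_div_two_pow
    (r := ‖remainder a x t - remainder a' x t‖ - 2 * B * Real.exp (rate Λ * x))
    (M := 2 * Λ ^ 2 * Real.exp (rate Λ * x)) fun n => by
      have := key n x t
      rw [add_mul] at this
      rw [mul_div_right_comm]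
      linarith
  linarith

end Transmutation
end

noncomputable section
namespace Transmutation

/-! ### The transmutation kernel and the norms of its slices -/

variable {a a' : ℝ → ℂ}

theorem map_sub_div_two (x : ℝ) :
    Measure.map (fun t : ℝ => (x - t) / 2) volume = (2 : ENNReal) • volume := by
  have h1 : (fun t : ℝ => (x - t) / 2) = (fun t => (1 / 2 : ℝ) * t) ∘ fun t => x - t := by
    funext t; simp; ring
  rw [h1, ← Measure.map_map (by fun_prop) (by fun_prop),
    (Measure.measurePreserving_sub_left (volume : Measure ℝ) x).map_eq, Real.map_volume_mul_left (by norm_num)]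
  norm_num

/-- The substitution s = (x-t)/2 costs a factor √2 in the L² norm, which the prefactor 1/2 more than
absorbs. -/
theorem eLpNorm_seed_le (ha : IsCoeff a) (x : ℝ) :
    eLpNorm (seed a x) 2 volume ≤ eLpNorm a 2 volume := by
  have hmap := eLpNorm_map_measure (p := 2) (μ := volume) (f := fun t : ℝ => (x - t) / 2) (g := a)
    ha.meas.aestronglyMeasurable (by fun_prop)
  rw [map_sub_div_two, eLpNorm_smul_measure_of_ne_top ENNReal.ofNat_ne_top] at hmap
  have h1 : eLpNorm (seed a x) 2 volume ≤
      eLpNorm ((1 / 2 : ℝ) • (a ∘ fun t : ℝ => (x - t) / 2)) 2 volume := by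
    refine eLpNorm_mono fun t => ?_
    unfold seed
    split_ifs
    · simp [div_eq_mul_inv, mul_comm]
    · rw [norm_zero]; positivity
  refine h1.trans ?_
  rw [eLpNorm_const_smul, ← hmap, smul_eq_mul, ← mul_assoc]
  refine mul_le_of_le_one_left' ?_
  have h2 : ‖(1 / 2 : ℝ)‖ₑ = 2⁻¹ := by
    rw [← ofReal_norm, Real.norm_of_nonneg (by norm_num), one_div,
      ENNReal.ofReal_inv_of_pos (by norm_num)]
    simp
  rw [h2, ENNReal.inv_mul_le_iff two_ne_zero ENNReal.ofNat_ne_top, mul_one]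
  calc (2 : ENNReal) ^ (1 / (2 : ENNReal)).toReal ≤ 2 ^ (1 : ℝ) :=
        ENNReal.rpow_le_rpow_of_exponent_le one_le_two (by norm_num)
    _ = 2 := ENNReal.rpow_one 2

/-- The Lipschitz constant of the slices `goursat a x` as functions of `a`. -/
def sliceConst (Λ ℓ : ℝ) : ℝ :=
  1 + √(2 * ℓ) * (2 * (Λ + Λ ^ 2) * Real.exp (rate Λ * ℓ))

theorem stronglyMeasurable_slice {φ : ℝ → ℝ → ℂ}
    (hφ : StronglyMeasurable (Function.uncurry φ)) (x : ℝ) : StronglyMeasurable (φ x) :=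
  hφ.comp_measurable measurable_prodMk_left

theorem μ₁_univ (x : ℝ) : μ₁ x univ = ENNReal.ofReal (2 * x) := by
  rw [Measure.restrict_apply_univ, Real.volume_Ioo]; ring_nf

/-- The free term is linear in a and contributes the constant 1. The remainders differ by a
uniformly small amount, and a sup bound on (-x, x) costs at most √(2ℓ) in L². -/
theorem eLpNorm_goursat_sub_le (ha : IsCoeff a) (ha' : IsCoeff a') {Λ ℓ : ℝ}
    (hΛ : norm₂ a volume ≤ Λ) (hΛ' : norm₂ a' volume ≤ Λ) {x : ℝ} (hx : x ∈ Ioc 0 ℓ) :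
    eLpNorm (fun t => goursat a x t - goursat a' x t) 2 (μ₁ x) ≤
      ENNReal.ofReal (sliceConst Λ ℓ * norm₂ (a - a') volume) := by
  have hd := ha.sub ha'
  have hΛ0 : 0 ≤ Λ := ENNReal.toReal_nonneg.trans hΛ
  have hn : 0 ≤ norm₂ (a - a') volume := ENNReal.toReal_nonneg
  have heq : (fun t => goursat a x t - goursat a' x t) =
      seed (a - a') x + fun t => remainder a x t - remainder a' x t := by
    funext t
    simp only [goursat, seed, Pi.add_apply, Pi.sub_apply]
    split_ifs <;> ring
  have h1 : eLpNorm (seed (a - a') x) 2 (μ₁ x) ≤ ENNReal.ofReal (norm₂ (a - a') volume) := by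
    rw [ENNReal.ofReal_toReal hd.memLp.eLpNorm_ne_top]
    exact (eLpNorm_restrict_le _ _ _ _).trans (eLpNorm_seed_le hd x)
  have h2 : eLpNorm (fun t => remainder a x t - remainder a' x t) 2 (μ₁ x) ≤
      ENNReal.ofReal (√(2 * ℓ) * (2 * (Λ + Λ ^ 2) * Real.exp (rate Λ * ℓ)) *
        norm₂ (a - a') volume) := by
    refine (eLpNorm_le_of_ae_bound (C := 2 * ((Λ + Λ ^ 2) * norm₂ (a - a') volume) *
      Real.exp (rate Λ * ℓ)) (ae_of_all _ fun t => ?_)).trans ?_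
    · refine (norm_remainder_sub_le ha ha' hΛ hΛ' x t).trans ?_
      have := (rate_pos Λ).le
      gcongr
      exact hx.2
    · rw [μ₁_univ, mul_assoc (√(2 * ℓ)), ENNReal.ofReal_mul (Real.sqrt_nonneg _)]
      refine mul_le_mul' ?_ (ENNReal.ofReal_le_ofReal ?_)
      · rw [ENNReal.toReal_ofNat, Real.sqrt_eq_rpow,
          ENNReal.ofReal_rpow_of_nonneg (by linarith [hx.1]) (by norm_num), ← one_div]
        gcongr
        · linarith [hx.1]
        · exact hx.2
      · exact le_of_eq (by ring)
  rw [heq]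
  refine (eLpNorm_add_le (stronglyMeasurable_slice
    (stronglyMeasurable_seed hd.meas) x).aestronglyMeasurable
    ((stronglyMeasurable_slice (stronglyMeasurable_remainder ha) x).sub
    (stronglyMeasurable_slice (stronglyMeasurable_remainder ha') x)).aestronglyMeasurable
    one_le_two).trans ?_
  rw [sliceConst, add_mul, one_mul, ENNReal.ofReal_add hn (by positivity)]
  exact add_le_add h1 h2

theorem eLpNorm_comp_neg (φ : ℝ → ℂ) (hφ : StronglyMeasurable φ) (x : ℝ) :
    eLpNorm (fun t => φ (-t)) 2 (μ₁ x) = eLpNorm φ 2 (μ₁ x) := by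
  have h := (Measure.measurePreserving_neg (volume : Measure ℝ)).restrict_preimage
    (measurableSet_Ioo (a := -x) (b := x))
  have hpre : Neg.neg ⁻¹' Ioo (-x) x = Ioo (-x) x := by
    ext t; simp only [mem_preimage, mem_Ioo]; constructor <;> rintro ⟨h1, h2⟩ <;> constructor <;>
      linarith
  rw [hpre] at h
  exact eLpNorm_comp_measurePreserving hφ.aestronglyMeasurable h

/-- The transmutation kernel, in terms of the logarithmic derivative `a = f'/f`. -/
def transKernel (a : ℝ → ℂ) (x t : ℝ) : ℂ :=
  (1 / 2) * (goursat a x t + goursat a x (-t) + (goursat (-a) x t - goursat (-a) x (-t)))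

theorem stronglyMeasurable_transKernel (ha : IsCoeff a) :
    StronglyMeasurable (Function.uncurry (transKernel a)) := by
  have h1 := stronglyMeasurable_goursat ha
  have h2 := stronglyMeasurable_goursat ha.neg
  have hm : Measurable fun p : ℝ × ℝ => (p.1, -p.2) := by fun_prop
  exact (((h1.add (h1.comp_measurable hm)).add (h2.sub (h2.comp_measurable hm))).const_mul _)

/-- Reflection in t preserves the norm on (-x, x), so four differences of the same size appear with
the prefactor 1/2. -/
theorem eLpNorm_transKernel_sub_le (ha : IsCoeff a) (ha' : IsCoeff a') {Λ ℓ : ℝ}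
    (hΛ : norm₂ a volume ≤ Λ) (hΛ' : norm₂ a' volume ≤ Λ) {x : ℝ} (hx : x ∈ Ioc 0 ℓ) :
    eLpNorm (fun t => transKernel a x t - transKernel a' x t) 2 (μ₁ x) ≤
      ENNReal.ofReal (2 * (sliceConst Λ ℓ * norm₂ (a - a') volume)) := by
  have hneg : ∀ b : ℝ → ℂ, norm₂ (-b) volume = norm₂ b volume := fun b => by
    rw [norm₂, eLpNorm_neg]
  set D : ℝ → ℂ := fun t => goursat a x t - goursat a' x t with hD
  set E : ℝ → ℂ := fun t => goursat (-a) x t - goursat (-a') x t with hE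
  have mD : StronglyMeasurable D := (stronglyMeasurable_slice (stronglyMeasurable_goursat ha) x).sub
    (stronglyMeasurable_slice (stronglyMeasurable_goursat ha') x)
  have mE : StronglyMeasurable E :=
    (stronglyMeasurable_slice (stronglyMeasurable_goursat ha.neg) x).sub
    (stronglyMeasurable_slice (stronglyMeasurable_goursat ha'.neg) x)
  have bD := eLpNorm_goursat_sub_le ha ha' hΛ hΛ' hx
  have bE := eLpNorm_goursat_sub_le (Λ := Λ) ha.neg ha'.neg (by rwa [hneg]) (by rwa [hneg]) hx
  rw [show -a - -a' = -(a - a') by ring, hneg] at bE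
  have heq : (fun t => transKernel a x t - transKernel a' x t) =
      (1 / 2 : ℝ) • ((D + fun t => D (-t)) + (E - fun t => E (-t))) := by
    funext t
    simp only [transKernel, hD, hE, Pi.add_apply, Pi.sub_apply, Pi.smul_apply, Complex.real_smul]
    push_cast
    ring
  set c := ENNReal.ofReal (sliceConst Λ ℓ * norm₂ (a - a') volume) with hc
  have mDn : StronglyMeasurable fun t => D (-t) := mD.comp_measurable measurable_neg
  have mEn : StronglyMeasurable fun t => E (-t) := mE.comp_measurable measurable_neg
  rw [heq, eLpNorm_const_smul]
  have h4 : eLpNorm ((D + fun t => D (-t)) + (E - fun t => E (-t))) 2 (μ₁ x) ≤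
      (c + c) + (c + c) := by
    refine (eLpNorm_add_le (mD.add mDn).aestronglyMeasurable (mE.sub mEn).aestronglyMeasurable
      one_le_two).trans (add_le_add ?_ ?_)
    · refine (eLpNorm_add_le mD.aestronglyMeasurable mDn.aestronglyMeasurable
        one_le_two).trans (add_le_add bD ?_)
      rw [eLpNorm_comp_neg D mD]; exact bD
    · refine (eLpNorm_sub_le mE.aestronglyMeasurable mEn.aestronglyMeasurable
        one_le_two).trans (add_le_add bE ?_)
      rw [eLpNorm_comp_neg E mE]; exact bE
  refine (mul_le_mul_right h4 _).trans ?_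
  have hhalf : ‖(1 / 2 : ℝ)‖ₑ = 2⁻¹ := by
    rw [← ofReal_norm, Real.norm_of_nonneg (by norm_num), one_div,
      ENNReal.ofReal_inv_of_pos (by norm_num)]
    simp
  rw [hhalf, ENNReal.ofReal_mul two_pos.le, ← hc, ENNReal.ofReal_ofNat, ← two_mul, ← two_mul,
    ← mul_assoc, ENNReal.inv_mul_cancel two_ne_zero ENNReal.ofNat_ne_top, one_mul]

theorem iterate_zero (n : ℕ) : iterate 0 n = 0 := by
  cases n <;> (funext x t; simp [iterate, volterra])

theorem goursat_zero : goursat 0 = 0 := by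
  funext x t
  simp [goursat, seed, remainder, iterate_zero]

theorem transKernel_zero : transKernel 0 = 0 := by
  funext x t
  simp [transKernel, goursat_zero]

/-- The Lipschitz estimate against the coefficient 0, whose kernel vanishes. -/
theorem eLpNorm_transKernel_le (ha : IsCoeff a) {ℓ x : ℝ} (hx : x ∈ Ioc 0 ℓ) :
    eLpNorm (transKernel a x) 2 (μ₁ x) ≤
      ENNReal.ofReal (2 * (sliceConst (norm₂ a volume) ℓ * norm₂ a volume)) := by
  simpa [transKernel_zero] using eLpNorm_transKernel_sub_le ha isCoeff_zero le_rfl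
    (by rw [norm₂, eLpNorm_zero]; exact ENNReal.toReal_nonneg) hx

theorem eLpNorm_goursat_le (ha : IsCoeff a) {ℓ x : ℝ} (hx : x ∈ Ioc 0 ℓ) :
    eLpNorm (goursat a x) 2 (μ₁ x) ≤
      ENNReal.ofReal (sliceConst (norm₂ a volume) ℓ * norm₂ a volume) := by
  simpa [goursat_zero] using eLpNorm_goursat_sub_le ha isCoeff_zero le_rfl
    (by rw [norm₂, eLpNorm_zero]; exact ENNReal.toReal_nonneg) hx

end Transmutation
end

noncomputable section
namespace Transmutation

/-! ### Exponential solutions -/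

/-- Jointly measurable kernels on the triangle with uniformly integrable slices. -/
structure IsSlice (ℓ : ℝ) (φ : ℝ → ℝ → ℂ) : Prop where
  meas : StronglyMeasurable (Function.uncurry φ)
  supp : ∀ x t, x ≤ |t| → φ x t = 0
  bound : ∃ C : ENNReal, C ≠ ⊤ ∧ ∀ x ∈ Icc 0 ℓ, ∫⁻ t, ‖φ x t‖ₑ ≤ C

/-- The exponential transform of the slices of a kernel. -/
def expTransform (φ : ℝ → ℝ → ℂ) (ρ : ℂ) (x : ℝ) : ℂ :=
  ∫ t : ℝ, φ x t * Complex.exp (Complex.I * ρ * t)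

variable {a : ℝ → ℂ} {φ : ℝ → ℝ → ℂ} {ℓ : ℝ}

theorem norm_exp_I_mul_le (ρ : ℂ) {t X : ℝ} (h : |t| ≤ X) :
    ‖Complex.exp (Complex.I * ρ * t)‖ ≤ Real.exp (‖ρ‖ * X) := by
  refine (Complex.norm_exp_le_exp_norm _).trans (Real.exp_le_exp.2 ?_)
  rw [norm_mul, norm_mul, Complex.norm_I, one_mul, Complex.norm_real, Real.norm_eq_abs]
  gcongr

theorem isSlice_of_eLpNorm_le (hφ : StronglyMeasurable (Function.uncurry φ))
    (hs : ∀ x t, x ≤ |t| → φ x t = 0) {C : ENNReal} (hC : C ≠ ⊤)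
    (h : ∀ x ∈ Ioc 0 ℓ, eLpNorm (φ x) 2 (μ₁ x) ≤ C) : IsSlice ℓ φ := by
  refine ⟨hφ, hs, C * ENNReal.ofReal (2 * ℓ) ^ (1 / 2 : ℝ),
    ENNReal.mul_ne_top hC (by finiteness), fun x hx => ?_⟩
  rcases hx.1.eq_or_lt with rfl | h0
  · simp [fun t => hs 0 t (abs_nonneg t)]
  have h1 : ∫⁻ t, ‖φ x t‖ₑ = eLpNorm (φ x) 1 (μ₁ x) := by
    rw [eLpNorm_one_eq_lintegral_enorm, setLIntegral_eq_of_support_subset]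
    intro t ht
    by_contra hcon
    refine ht ?_
    dsimp only
    rw [hs x t ?_, enorm_zero]
    by_contra! hlt
    exact hcon (abs_lt.1 hlt)
  rw [h1]
  have h2 := eLpNorm_le_eLpNorm_mul_rpow_measure_univ (μ := μ₁ x) one_le_two
    (stronglyMeasurable_slice hφ x).aestronglyMeasurable
  refine h2.trans (mul_le_mul' (h x ⟨h0, hx.2⟩) ?_)
  rw [μ₁_univ]
  norm_num
  gcongr
  exact hx.2

theorem isSlice_goursat (ha : IsCoeff a) (ℓ : ℝ) : IsSlice ℓ (goursat a) :=
  isSlice_of_eLpNorm_le (stronglyMeasurable_goursat ha) goursat_eq_zero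
    ENNReal.ofReal_ne_top fun _ hx => eLpNorm_goursat_le ha hx

theorem isSlice_seed (ha : IsCoeff a) (ℓ : ℝ) : IsSlice ℓ (seed a) :=
  isSlice_of_eLpNorm_le (stronglyMeasurable_seed ha.meas) seed_eq_zero
    ha.memLp.eLpNorm_ne_top fun x _ => (eLpNorm_restrict_le _ _ _ _).trans (eLpNorm_seed_le ha x)

theorem IsSlice.enorm_mul_exp_le (hφ : IsSlice ℓ φ) (ρ : ℂ) {x : ℝ} (hx : x ∈ Icc 0 ℓ) (t : ℝ) :
    ‖φ x t * Complex.exp (Complex.I * ρ * t)‖ₑ ≤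
      ‖φ x t‖ₑ * ENNReal.ofReal (Real.exp (‖ρ‖ * ℓ)) := by
  rcases le_or_gt x |t| with h | h
  · simp [hφ.supp x t h]
  · rw [enorm_mul, ← ofReal_norm (Complex.exp _)]
    gcongr
    exact norm_exp_I_mul_le ρ (h.le.trans hx.2)

theorem IsSlice.stronglyMeasurable_mul_exp (hφ : IsSlice ℓ φ) (ρ : ℂ) :
    StronglyMeasurable (fun p : ℝ × ℝ => φ p.1 p.2 * Complex.exp (Complex.I * ρ * p.2)) :=
  hφ.meas.mul (Continuous.stronglyMeasurable (by fun_prop))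

theorem IsSlice.integrable (hφ : IsSlice ℓ φ) (ρ : ℂ) {x : ℝ} (hx : x ∈ Icc 0 ℓ) :
    Integrable (fun t : ℝ => φ x t * Complex.exp (Complex.I * ρ * t)) := by
  obtain ⟨C, hC, h⟩ := hφ.bound
  refine ⟨((hφ.stronglyMeasurable_mul_exp ρ).comp_measurable
    measurable_prodMk_left).aestronglyMeasurable, ?_⟩
  refine (lintegral_mono (hφ.enorm_mul_exp_le ρ hx)).trans_lt ?_
  rw [lintegral_mul_const' _ _ ENNReal.ofReal_ne_top]
  exact ENNReal.mul_lt_top ((h x hx).trans_lt hC.lt_top) ENNReal.ofReal_lt_top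

theorem IsSlice.exists_norm_expTransform_le (hφ : IsSlice ℓ φ) (ρ : ℂ) :
    ∃ C : ℝ, ∀ x ∈ Icc 0 ℓ, ‖expTransform φ ρ x‖ ≤ C := by
  obtain ⟨C, hC, h⟩ := hφ.bound
  refine ⟨(C * ENNReal.ofReal (Real.exp (‖ρ‖ * ℓ))).toReal, fun x hx => ?_⟩
  rw [← toReal_enorm]
  refine ENNReal.toReal_mono (ENNReal.mul_ne_top hC ENNReal.ofReal_ne_top) ?_
  refine (enorm_integral_le_lintegral_enorm _).trans
    ((lintegral_mono (hφ.enorm_mul_exp_le ρ hx)).trans ?_)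
  rw [lintegral_mul_const' _ _ ENNReal.ofReal_ne_top]
  gcongr
  exact h x hx

theorem IsSlice.stronglyMeasurable_expTransform (hφ : IsSlice ℓ φ) (ρ : ℂ) :
    StronglyMeasurable (expTransform φ ρ) :=
  (hφ.stronglyMeasurable_mul_exp ρ).integral_prod_right'

/-- After Fubini, the substitution t ↦ x-s-t turns exp(iρt) into exp(iρ(x-s)) exp(-iρt). This
reflection is the source of -ρ on the right. -/
theorem expTransform_volterra (ha : IsCoeff a) (hφ : IsSlice ℓ φ) (ρ : ℂ) {x : ℝ}
    (hx : x ∈ Icc 0 ℓ) : expTransform (volterra a φ) ρ x =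
      ∫ s in Ioc 0 x, a s * Complex.exp (Complex.I * ρ * (x - s)) * expTransform φ (-ρ) s := by
  obtain ⟨C, hC, hb⟩ := hφ.bound
  set G : ℝ → ℝ → ℂ := fun s t =>
    a s * φ s (x - s - t) * Complex.exp (Complex.I * ρ * t) with hG
  have hmeas : StronglyMeasurable (Function.uncurry G) :=
    ((ha.meas.comp_measurable measurable_fst).mul (hφ.meas.comp_measurable
      (show Measurable fun p : ℝ × ℝ => (p.1, x - p.1 - p.2) by fun_prop))).mul
      (Continuous.stronglyMeasurable (by fun_prop))
  have hbound : ∀ s ∈ Ioc 0 x, ∀ t, ‖G s t‖ₑ ≤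
      ‖a s‖ₑ * (‖φ s (x - s - t)‖ₑ * ENNReal.ofReal (Real.exp (‖ρ‖ * ℓ))) := by
    intro s hs t
    rcases le_or_gt s |x - s - t| with h | h
    · simp [hG, hφ.supp _ _ h]
    · rw [hG]
      simp only [enorm_mul]
      rw [← ofReal_norm (Complex.exp _), mul_assoc]
      gcongr
      refine norm_exp_I_mul_le ρ ?_
      rw [abs_lt] at h
      rw [abs_le]
      constructor <;> linarith [hs.1, hs.2, hx.2]
  have hint : Integrable (Function.uncurry G) ((volume.restrict (Ioc 0 x)).prod volume) := by
    refine ⟨hmeas.aestronglyMeasurable, ?_⟩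
    rw [HasFiniteIntegral, lintegral_prod _ hmeas.aestronglyMeasurable.enorm]
    calc ∫⁻ s in Ioc 0 x, ∫⁻ t, ‖G s t‖ₑ
        ≤ ∫⁻ s in Ioc 0 x, ‖a s‖ₑ * (C * ENNReal.ofReal (Real.exp (‖ρ‖ * ℓ))) := by
          refine setLIntegral_mono' measurableSet_Ioc fun s hs => ?_
          refine (lintegral_mono (hbound s hs)).trans ?_
          rw [lintegral_const_mul' _ _ enorm_ne_top,
            lintegral_mul_const' _ _ ENNReal.ofReal_ne_top,
            lintegral_sub_left_eq_self (fun t => ‖φ s t‖ₑ) (x - s)]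
          gcongr
          exact hb s ⟨hs.1.le, hs.2.trans hx.2⟩
      _ < ⊤ := by
          rw [lintegral_mul_const' _ _ (by finiteness)]
          refine ENNReal.mul_lt_top ?_ (by finiteness)
          exact ((ha.memLp.restrict (Ioc 0 x)).integrable one_le_two).2
  have hswap := integral_integral_swap (f := G) (μ := volume.restrict (Ioc 0 x)) (ν := volume) hint
  calc expTransform (volterra a φ) ρ x = ∫ t, ∫ s in Ioc 0 x, G s t := by
        refine integral_congr_ae (ae_of_all _ fun t => ?_)
        simp only [volterra, hG]
        rw [integral_mul_const]
    _ = ∫ s in Ioc 0 x, ∫ t, G s t := hswap.symm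
    _ = _ := by
        refine integral_congr_ae (ae_of_all _ fun s => ?_)
        simp only [hG, expTransform]
        rw [← integral_const_mul, ← integral_sub_left_eq_self _ volume (x - s)]
        refine integral_congr_ae (ae_of_all _ fun t => ?_)
        have : Complex.exp (Complex.I * ρ * ((x - s - t : ℝ) : ℂ)) =
            Complex.exp (Complex.I * ρ * (x - s)) * Complex.exp (Complex.I * -ρ * t) := by
          rw [← Complex.exp_add]; congr 1; push_cast; ring
        dsimp only
        rw [this, sub_sub_cancel]
        ring

/-- Formally the free term is the Volterra operator applied to the delta function at t = s, whose
transform at -ρ is exp(-iρs). The proof substitutes s = (x-t)/2; the Jacobian cancels the factor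
1/2. -/
theorem expTransform_seed (a : ℝ → ℂ) (ρ : ℂ) {x : ℝ} (hx : 0 ≤ x) :
    expTransform (seed a) ρ x = ∫ s in Ioc 0 x, a s * Complex.exp (Complex.I * ρ * (x - s)) *
      Complex.exp (Complex.I * -ρ * s) := by
  set g : ℝ → ℂ := fun s => a s * Complex.exp (Complex.I * ρ * (x - s)) *
      Complex.exp (Complex.I * -ρ * s) with hg
  have h1 : expTransform (seed a) ρ x = ∫ t in Ioo (-x) x, g (x / 2 - t / 2) / 2 := by
    rw [expTransform, ← integral_indicator measurableSet_Ioo]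
    refine integral_congr_ae (ae_of_all _ fun t => ?_)
    by_cases h : t ∈ Ioo (-x) x
    · rw [indicator_of_mem h]
      have h2 : |t| < x := abs_lt.2 h
      simp only [seed, if_pos h2, hg, mul_assoc]
      rw [← Complex.exp_add, sub_div]
      have : Complex.I * (ρ * t) = Complex.I * (ρ * (x - ((x / 2 - t / 2 : ℝ) : ℂ))) +
          Complex.I * (-ρ * ((x / 2 - t / 2 : ℝ) : ℂ)) := by
        push_cast; ring
      rw [this]; ring
    · rw [indicator_of_notMem h]
      dsimp only
      rw [seed_eq_zero x t ?_, zero_mul]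
      by_contra! hlt
      exact h (abs_lt.1 hlt)
  rw [h1, ← integral_Ioc_eq_integral_Ioo, ← intervalIntegral.integral_of_le (by linarith),
    ← intervalIntegral.integral_of_le hx, intervalIntegral.integral_div,
    intervalIntegral.integral_comp_sub_div g two_ne_zero (x / 2),
    show x / 2 - x / 2 = 0 by ring, show x / 2 - -x / 2 = x by ring, Complex.real_smul]
  push_cast
  ring

/-- The solution of `z' (ρ) = iρ z(ρ) + a z(-ρ)`, `z(ρ)(0) = 1`. -/
def jost (a : ℝ → ℂ) (ρ : ℂ) (x : ℝ) : ℂ :=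
  Complex.exp (Complex.I * ρ * x) + expTransform (goursat a) ρ x

theorem exists_norm_jost_le (ha : IsCoeff a) (ρ : ℂ) (ℓ : ℝ) :
    ∃ C : ℝ, ∀ x ∈ Icc 0 ℓ, ‖jost a ρ x‖ ≤ C := by
  obtain ⟨C, hC⟩ := (isSlice_goursat ha ℓ).exists_norm_expTransform_le ρ
  exact ⟨Real.exp (‖ρ‖ * ℓ) + C, fun x hx => (norm_add_le _ _).trans (add_le_add
    (norm_exp_I_mul_le ρ (by rw [abs_of_nonneg hx.1]; exact hx.2)) (hC x hx))⟩

theorem stronglyMeasurable_jost (ha : IsCoeff a) (ρ : ℂ) : StronglyMeasurable (jost a ρ) :=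
  (Continuous.stronglyMeasurable (by fun_prop)).add
    ((isSlice_goursat ha 0).stronglyMeasurable_expTransform ρ)

theorem memLp_mul_of_bound (ha : IsCoeff a) {u : ℝ → ℂ} (hu : StronglyMeasurable u) {C : ℝ}
    (hC : ∀ x ∈ Icc 0 ℓ, ‖u x‖ ≤ C) : MemLp (fun x => a x * u x) 2 (μ₀ ℓ) := by
  refine MemLp.mul' (p := 2) (q := ⊤) (r := 2)
    (memLp_top_of_bound hu.aestronglyMeasurable C ?_) (ha.memLp.restrict _)
  filter_upwards [ae_restrict_mem measurableSet_Ioo] with x hx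
  exact hC x (Ioo_subset_Icc_self hx)

theorem memLp_jost_density (ha : IsCoeff a) (ρ : ℂ) (ℓ : ℝ) :
    MemLp (fun s => a s * (Complex.exp (-(Complex.I * ρ * s)) * jost a (-ρ) s)) 2 (μ₀ ℓ) := by
  obtain ⟨C, hC⟩ := exists_norm_jost_le ha (-ρ) ℓ
  refine memLp_mul_of_bound ha
    ((Continuous.stronglyMeasurable (by fun_prop)).mul (stronglyMeasurable_jost ha (-ρ)))
    (C := Real.exp (‖ρ‖ * ℓ) * C) fun x hx => ?_
  rw [norm_mul]
  have h1 := norm_exp_I_mul_le (-ρ) (t := x) (X := ℓ) (by rw [abs_of_nonneg hx.1]; exact hx.2)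
  rw [norm_neg, show Complex.I * -ρ * x = -(Complex.I * ρ * x) by ring] at h1
  exact mul_le_mul h1 (hC x hx) (norm_nonneg _) (Real.exp_pos _).le

/-- The transforms of the free term and of the Volterra term share the weight a(s) exp(iρ(x-s)), and
the factors they multiply add up to `jost a (-ρ) s`. The result is Duhamel's formula for z(ρ)' = iρ
z(ρ) + a z(-ρ). -/
theorem jost_eq (ha : IsCoeff a) (ρ : ℂ) {x : ℝ} (hx : x ∈ Icc 0 ℓ) :
    jost a ρ x = Complex.exp (Complex.I * ρ * x) *
      (1 + ∫ s in (0 : ℝ)..x, a s * (Complex.exp (-(Complex.I * ρ * s)) * jost a (-ρ) s)) := by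
  have hG := isSlice_goursat ha ℓ
  have hS := isSlice_seed ha ℓ
  have h1 : expTransform (goursat a) ρ x =
      expTransform (seed a) ρ x + expTransform (volterra a (goursat a)) ρ x := by
    have hV : ∀ t, volterra a (goursat a) x t = goursat a x t - seed a x t := fun t => by
      rw [goursat_eq ha x t]; ring
    unfold expTransform
    simp_rw [hV, sub_mul]
    rw [integral_sub (hG.integrable ρ hx) (hS.integrable ρ hx)]
    ring
  obtain ⟨C, hC⟩ := hG.exists_norm_expTransform_le (-ρ)
  have hmon : volume.restrict (Ioc 0 x) ≤ μ₀ ℓ := by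
    rw [μ₀, restrict_Ioo_eq_restrict_Ioc]
    exact Measure.restrict_mono (Ioc_subset_Ioc_right hx.2) le_rfl
  have key : ∀ (u : ℝ → ℂ) (C : ℝ), StronglyMeasurable u → (∀ x ∈ Icc 0 ℓ, ‖u x‖ ≤ C) →
      Integrable (fun s => a s * Complex.exp (Complex.I * ρ * (x - s)) * u s)
        (volume.restrict (Ioc 0 x)) := by
    intro u C hu hC
    have hexp : ∀ s ∈ Icc 0 ℓ, ‖Complex.exp (Complex.I * ρ * (x - s))‖ ≤
        Real.exp (‖ρ‖ * ℓ) := fun s hs => by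
      have := norm_exp_I_mul_le ρ (t := x - s) (X := ℓ)
        (by rw [abs_le]; constructor <;> linarith [hs.1, hs.2, hx.1, hx.2])
      simpa using this
    have := memLp_mul_of_bound (ℓ := ℓ) ha (u := fun s => Complex.exp (Complex.I * ρ * (x - s)) * u s)
      ((Continuous.stronglyMeasurable (by fun_prop)).mul hu) (C := Real.exp (‖ρ‖ * ℓ) * C)
      fun s hs => by
        rw [norm_mul]
        exact mul_le_mul (hexp s hs) (hC s hs) (norm_nonneg _) (Real.exp_pos _).le
    refine ((this.integrable one_le_two).mono_measure hmon).congr (ae_of_all _ fun s => ?_)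
    simp only [mul_assoc]
  have i1 := key (fun s => Complex.exp (Complex.I * -ρ * s)) (Real.exp (‖-ρ‖ * ℓ))
    (Continuous.stronglyMeasurable (by fun_prop)) fun s hs =>
      norm_exp_I_mul_le (-ρ) (by rw [abs_of_nonneg hs.1]; exact hs.2)
  have i2 := key _ C (hG.stronglyMeasurable_expTransform (-ρ)) hC
  rw [jost, h1, expTransform_seed a ρ hx.1, expTransform_volterra ha hG ρ hx, ← integral_add i1 i2,
    mul_add, mul_one, intervalIntegral.integral_of_le hx.1, ← integral_const_mul]
  congr 1
  refine integral_congr_ae (ae_of_all _ fun s => ?_)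
  have : Complex.exp (Complex.I * ρ * (x - s)) = Complex.exp (Complex.I * ρ * x) *
      Complex.exp (-(Complex.I * ρ * s)) := by
    rw [← Complex.exp_add]; congr 1; ring
  dsimp only [jost]
  rw [this]
  ring

theorem MemW12.congr_eqOn (hℓ : 0 ≤ ℓ) {u v : ℝ → ℂ} (hu : MemW12 ℓ u) (h : EqOn v u (Icc 0 ℓ)) :
    MemW12 ℓ v ∧ deriv v =ᵐ[μ₀ ℓ] deriv u :=
  memW12_of_eq_integral hℓ hu.deriv_memLp (u 0) fun x hx => by rw [h hx, hu.eq_integral hℓ hx]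

theorem memW12_jost (hℓ : 0 ≤ ℓ) (ha : IsCoeff a) (ρ : ℂ) : MemW12 ℓ (jost a ρ) ∧
    deriv (jost a ρ) =ᵐ[μ₀ ℓ] fun x => Complex.I * ρ * jost a ρ x + a x * jost a (-ρ) x := by
  set v : ℝ → ℂ := fun s => a s * (Complex.exp (-(Complex.I * ρ * s)) * jost a (-ρ) s) with hv
  set U : ℝ → ℂ := fun x => 1 + ∫ s in (0 : ℝ)..x, v s with hU
  obtain ⟨hU1, hU2⟩ := memW12_of_eq_integral (u := U) hℓ (memLp_jost_density ha ρ ℓ) 1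
    fun x _ => rfl
  have hE : ContDiff ℝ ∞ fun x : ℝ => Complex.exp (Complex.I * ρ * x) :=
    (contDiff_const.mul Complex.ofRealCLM.contDiff).cexp
  have hE' : ∀ x : ℝ, deriv (fun x : ℝ => Complex.exp (Complex.I * ρ * x)) x =
      Complex.I * ρ * Complex.exp (Complex.I * ρ * x) := fun x => by
    have := ((Complex.ofRealCLM.hasDerivAt (x := x)).const_mul (Complex.I * ρ)).cexp.deriv
    simpa [mul_comm] using this
  obtain ⟨h1, h2⟩ := (memW12_of_contDiff hE).mul hℓ hU1
  obtain ⟨h3, h4⟩ := h1.congr_eqOn hℓ (v := jost a ρ) fun x hx => jost_eq ha ρ hx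
  refine ⟨h3, ?_⟩
  filter_upwards [h2, h4, hU2, ae_restrict_mem measurableSet_Ioo] with x e2 e4 eU hx
  rw [e4, e2, hE', eU, jost_eq ha ρ (Ioo_subset_Icc_self hx), hU]
  have : Complex.exp (Complex.I * ρ * x) * Complex.exp (-(Complex.I * ρ * x)) = 1 := by
    rw [← Complex.exp_add, add_neg_cancel, Complex.exp_zero]
  dsimp only
  linear_combination (a x * jost a (-ρ) x) * this

theorem jost_zero (ha : IsCoeff a) (ρ : ℂ) : jost a ρ 0 = 1 := by
  rw [jost_eq (ℓ := 0) ha ρ (by simp)]; simp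

end Transmutation
end

noncomputable section
namespace Transmutation

/-! ### The Cauchy problem -/

variable {ℓ : ℝ} {f : ℝ → ℂ}

theorem IsImpedance.memLp_logD (hℓ : 0 ≤ ℓ) (hf : IsImpedance ℓ f) : MemLp (logD f) 2 (μ₀ ℓ) := by
  have h := MemLp.mul_continuousOn_μ₀ hf.memW12.deriv_memLp
    ((hf.memW12.continuousOn hℓ).inv₀ hf.ne_zero)
  exact h

/-- The logarithmic derivative of an impedance, extended by zero. -/
theorem IsImpedance.exists_coeff (hℓ : 0 ≤ ℓ) (hf : IsImpedance ℓ f) :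
    ∃ a : ℝ → ℂ, IsCoeff a ∧ a =ᵐ[μ₀ ℓ] logD f ∧ ∀ x ∉ Ioo 0 ℓ, a x = 0 := by
  have h := hf.memLp_logD hℓ
  refine ⟨(Ioo 0 ℓ).indicator (h.1.mk _), ⟨h.1.stronglyMeasurable_mk.indicator measurableSet_Ioo,
    ?_⟩, ?_, fun x hx => indicator_of_notMem hx _⟩
  · rw [memLp_indicator_iff_restrict measurableSet_Ioo]
    exact (memLp_congr_ae h.1.ae_eq_mk).1 h
  · filter_upwards [h.1.ae_eq_mk, ae_restrict_mem measurableSet_Ioo] with x hx hx'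
    rw [indicator_of_mem hx', hx]

/-- With a = f'/f, the integrand is y'φ' + a²yφ - a(yφ)' = (y' - ay)φ' - a(y' - ay)φ. Since y' - ay
has the representative w in W^{1,2}, the first term can be integrated by parts. -/
theorem schrodinger_eq (hℓ : 0 ≤ ℓ) (ha : MemLp (logD f) 2 (μ₀ ℓ)) {y w φ : ℝ → ℂ}
    (hy : MemW12 ℓ y) (hw : MemW12 ℓ w) (hyw : w =ᵐ[μ₀ ℓ] quasiDeriv f y) (hφ : MemW12Zero ℓ φ) :
    schrodinger ℓ f y φ = -∫ x in (0 : ℝ)..ℓ, (deriv w x + logD f x * w x) * φ x := by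
  have hr := right_mem_Icc.2 hℓ
  have hφ1 := hφ.memW12.deriv_memLp
  have cφ := hφ.memW12.continuousOn hℓ
  have hwφ : Integrable (fun x => w x * deriv φ x) (μ₀ ℓ) :=
    MemLp.integrable_mul_μ₀ (ContinuousOn.memLp_μ₀ (hw.continuousOn hℓ)) hφ1
  have hawφ : Integrable (fun x => logD f x * w x * φ x) (μ₀ ℓ) :=
    (MemLp.mul_continuousOn_μ₀ (MemLp.mul_continuousOn_μ₀ ha (hw.continuousOn hℓ)) cφ).integrable
      one_le_two
  have hw'φ : Integrable (fun x => deriv w x * φ x) (μ₀ ℓ) :=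
    (MemLp.mul_continuousOn_μ₀ hw.deriv_memLp cφ).integrable one_le_two
  have hy'φ' : Integrable (fun x => deriv y x * deriv φ x) (μ₀ ℓ) :=
    MemLp.integrable_mul_μ₀ hy.deriv_memLp hφ1
  obtain ⟨hyφ, hdyφ⟩ := hy.mul hℓ hφ.memW12
  have hq : Integrable (fun x => logD f x ^ 2 * (y x * φ x) -
      logD f x * deriv (fun x => y x * φ x) x) (μ₀ ℓ) := by
    refine Integrable.sub ?_ (MemLp.integrable_mul_μ₀ ha hyφ.deriv_memLp)
    have := MemLp.integrable_mul_μ₀ ha (MemLp.mul_continuousOn_μ₀ ha (hyφ.continuousOn hℓ))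
    refine this.congr (ae_of_all _ fun x => ?_)
    dsimp only; ring
  rw [schrodinger, potential, ← intervalIntegral.integral_add
    ((intervalIntegrable_iff_μ₀ hℓ).2 hy'φ') ((intervalIntegrable_iff_μ₀ hℓ).2 hq),
    intervalIntegral_congr_μ₀ (v := fun x => w x * deriv φ x - logD f x * w x * φ x) ?_ hr,
    intervalIntegral.integral_sub ((intervalIntegrable_iff_μ₀ hℓ).2 hwφ)
    ((intervalIntegrable_iff_μ₀ hℓ).2 hawφ), hw.integral_mul_deriv hℓ hφ]
  · simp_rw [add_mul]
    rw [intervalIntegral.integral_add ((intervalIntegrable_iff_μ₀ hℓ).2 hw'φ)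
      ((intervalIntegrable_iff_μ₀ hℓ).2 hawφ)]
    ring
  · filter_upwards [hyw, hdyφ] with x h1 h2
    rw [h2, h1, quasiDeriv]
    ring

theorem isExpSolution_of_system (hℓ : 0 ≤ ℓ) (ha : MemLp (logD f) 2 (μ₀ ℓ)) {y w : ℝ → ℂ} {ρ : ℂ}
    (hy : MemW12 ℓ y) (hw : MemW12 ℓ w)
    (hy' : deriv y =ᵐ[μ₀ ℓ] fun x => logD f x * y x + w x)
    (hw' : deriv w =ᵐ[μ₀ ℓ] fun x => -(logD f x * w x) - ρ ^ 2 * y x)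
    (hy0 : y 0 = 1) (hw0 : w 0 = Complex.I * ρ) : IsExpSolution ℓ f ρ y := by
  have hyw : w =ᵐ[μ₀ ℓ] quasiDeriv f y := by
    filter_upwards [hy'] with x hx
    rw [quasiDeriv, hx]; ring
  refine ⟨hy, fun φ hφ => ?_, hy0, w, hw, hyw, hw0⟩
  rw [schrodinger_eq hℓ ha hy hw hyw hφ, ← intervalIntegral.integral_neg]
  refine intervalIntegral_congr_μ₀ ?_ (right_mem_Icc.2 hℓ)
  filter_upwards [hw'] with x hx
  rw [hx]; ring

theorem IsExpSolution.exists_system (hℓ : 0 ≤ ℓ) (ha : MemLp (logD f) 2 (μ₀ ℓ)) {y : ℝ → ℂ} {ρ : ℂ}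
    (hy : IsExpSolution ℓ f ρ y) : ∃ w : ℝ → ℂ, MemW12 ℓ w ∧ w 0 = Complex.I * ρ ∧
      (deriv y =ᵐ[μ₀ ℓ] fun x => logD f x * y x + w x) ∧
      deriv w =ᵐ[μ₀ ℓ] fun x => -(logD f x * w x) - ρ ^ 2 * y x := by
  obtain ⟨w, hw, hyw, hw0⟩ := hy.init_quasi
  refine ⟨w, hw, hw0, ?_, ?_⟩
  · filter_upwards [hyw] with x hx
    rw [hx, quasiDeriv]; ring
  have h1 : MemLp (fun x => deriv w x + logD f x * w x) 2 (μ₀ ℓ) :=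
    hw.deriv_memLp.add (MemLp.mul_continuousOn_μ₀ ha (hw.continuousOn hℓ))
  have h2 : MemLp (fun x => ρ ^ 2 * y x) 2 (μ₀ ℓ) :=
    (ContinuousOn.memLp_μ₀ (hy.memW12.continuousOn hℓ)).const_mul _
  have hint : Integrable (fun x => deriv w x + logD f x * w x + ρ ^ 2 * y x) (μ₀ ℓ) :=
    (h1.add h2).integrable one_le_two
  -- The weak equation turns into w' + aw + ρ²y = 0 by the fundamental lemma of the calculus of
  -- variations; real smooth test functions with compact support suffice.
  have hzero := isOpen_Ioo.ae_eq_zero_of_integral_contDiff_smul_eq_zero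
    (IntegrableOn.locallyIntegrableOn hint) (fun g hg _ hgs => by
    have hφ0 : ∀ x ∉ Ioo 0 ℓ, g x = 0 := fun x hx => image_eq_zero_of_notMem_tsupport
      fun h => hx (hgs h)
    have hφ : MemW12Zero ℓ (fun x => (g x : ℂ)) :=
      ⟨memW12_of_contDiff (Complex.ofRealCLM.contDiff.comp hg), by simp [hφ0 0 (by simp)],
        by simp [hφ0 ℓ (by simp)]⟩
    have cφ := hφ.memW12.continuousOn hℓ
    have heq := hy.equation _ hφ
    rw [schrodinger_eq hℓ ha hy.memW12 hw hyw hφ, neg_eq_iff_add_eq_zero,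
      ← intervalIntegral.integral_add] at heq
    · rw [← heq, intervalIntegral.integral_of_le hℓ, integral_Ioc_eq_integral_Ioo,
        ← integral_indicator measurableSet_Ioo]
      refine integral_congr_ae (ae_of_all _ fun x => ?_)
      by_cases hx : x ∈ Ioo 0 ℓ
      · rw [indicator_of_mem hx]
        simp only [Complex.real_smul]
        ring
      · rw [indicator_of_notMem hx]
        simp [hφ0 x hx]
    · exact MemLp.intervalIntegrable_μ₀ hℓ (MemLp.mul_continuousOn_μ₀ h1 cφ)
    · exact MemLp.intervalIntegrable_μ₀ hℓ (MemLp.mul_continuousOn_μ₀ h2 cφ))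
  rw [EventuallyEq, ae_restrict_iff' measurableSet_Ioo]
  filter_upwards [hzero] with x hx hx'
  linear_combination hx hx'

/-- The differences of the solutions and of their quasi-derivatives solve the homogeneous system
with zero data, so Gronwall's lemma for an L² coefficient applies to |Y| + |W|. -/
theorem IsExpSolution.eqOn (hℓ : 0 ≤ ℓ) (hf : IsImpedance ℓ f) {y₁ y₂ : ℝ → ℂ} {ρ : ℂ}
    (h₁ : IsExpSolution ℓ f ρ y₁) (h₂ : IsExpSolution ℓ f ρ y₂) : EqOn y₁ y₂ (Icc 0 ℓ) := by
  have ha := hf.memLp_logD hℓ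
  obtain ⟨w₁, hw₁, hw₁0, e₁, e₁'⟩ := h₁.exists_system hℓ ha
  obtain ⟨w₂, hw₂, hw₂0, e₂, e₂'⟩ := h₂.exists_system hℓ ha
  obtain ⟨a, hac, haf, -⟩ := hf.exists_coeff hℓ
  set Y : ℝ → ℂ := fun x => y₁ x - y₂ x with hY
  set W : ℝ → ℂ := fun x => w₁ x - w₂ x with hW
  have cY : ContinuousOn Y (Icc 0 ℓ) :=
    (h₁.memW12.continuousOn hℓ).sub (h₂.memW12.continuousOn hℓ)
  have cW : ContinuousOn W (Icc 0 ℓ) := (hw₁.continuousOn hℓ).sub (hw₂.continuousOn hℓ)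
  have iY : ∀ x ∈ Icc 0 ℓ, Y x = ∫ s in (0 : ℝ)..x, (a s * Y s + W s) := fun x hx => by
    have hs : uIcc 0 x ⊆ uIcc 0 ℓ := by
      rw [uIcc_of_le hx.1, uIcc_of_le hℓ]; exact Icc_subset_Icc_right hx.2
    rw [hY]
    dsimp only
    rw [h₁.memW12.eq_integral hℓ hx, h₂.memW12.eq_integral hℓ hx, h₁.init, h₂.init,
      add_sub_add_left_eq_sub, ← intervalIntegral.integral_sub
      ((h₁.memW12.intervalIntegrable_deriv hℓ).mono_set hs)
      ((h₂.memW12.intervalIntegrable_deriv hℓ).mono_set hs)]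
    refine intervalIntegral_congr_μ₀ ?_ hx
    filter_upwards [e₁, e₂, haf] with s h1 h2 h3
    rw [h1, h2, h3, hW]; ring
  have iW : ∀ x ∈ Icc 0 ℓ, W x = ∫ s in (0 : ℝ)..x, (-(a s * W s) - ρ ^ 2 * Y s) := fun x hx => by
    have hs : uIcc 0 x ⊆ uIcc 0 ℓ := by
      rw [uIcc_of_le hx.1, uIcc_of_le hℓ]; exact Icc_subset_Icc_right hx.2
    rw [hW]
    dsimp only
    rw [hw₁.eq_integral hℓ hx, hw₂.eq_integral hℓ hx, hw₁0, hw₂0,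
      add_sub_add_left_eq_sub, ← intervalIntegral.integral_sub
      ((hw₁.intervalIntegrable_deriv hℓ).mono_set hs)
      ((hw₂.intervalIntegrable_deriv hℓ).mono_set hs)]
    refine intervalIntegral_congr_μ₀ ?_ hx
    filter_upwards [e₁', e₂', haf] with s h1 h2 h3
    rw [h1, h2, h3, hY]; ring
  -- This weight dominates the system: |aY + W| + |aW + ρ²Y| ≤ (|a| + 1 + |ρ²|)(|Y| + |W|).
  set k : ℝ → ℂ := (Ioo 0 ℓ).indicator fun s => ((‖a s‖ + (1 + ‖ρ ^ 2‖) : ℝ) : ℂ) with hk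
  have hkL : MemLp k 2 volume := by
    rw [memLp_indicator_iff_restrict measurableSet_Ioo]
    exact MemLp.ofReal ((hac.memLp.restrict _).norm.add (memLp_const _))
  set N : ℝ → ℝ := fun x => ‖Y x‖ + ‖W x‖ with hN
  have cN : ContinuousOn N (Icc 0 ℓ) := cY.norm.add cW.norm
  obtain ⟨M, hM⟩ := isCompact_Icc.exists_bound_of_continuousOn cN
  have hN0 : ∀ s, 0 ≤ N s := fun s => by positivity
  have hkN : ∀ x ∈ Icc 0 ℓ, IntegrableOn (fun s => ‖k s‖ * N s) (Ioc 0 x) := fun x hx => by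
    have h := MemLp.mul_continuousOn_μ₀ (ℓ := ℓ) (u := fun s => (N s : ℂ)) (hkL.restrict _)
      (Complex.continuous_ofReal.comp_continuousOn cN)
    have h' : IntegrableOn (fun s => k s * (N s : ℂ)) (Ioc 0 ℓ) := by
      rw [integrableOn_Ioc_iff_integrableOn_Ioo]
      exact h.integrable one_le_two
    refine (h'.mono_set (Ioc_subset_Ioc_right hx.2)).norm.congr (ae_of_all _ fun s => ?_)
    dsimp only
    rw [norm_mul, Complex.norm_real, Real.norm_of_nonneg (hN0 s)]
  have hle : ∀ x ∈ Icc 0 ℓ, N x ≤ ∫ s in Ioc 0 x, ‖k s‖ * N s := by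
    intro x hx
    have hsub : ∀ u : ℝ → ℂ, MemLp u 2 (μ₀ ℓ) → IntegrableOn (fun s => ‖u s‖) (Ioc 0 x) :=
      fun u hu => by
        have : IntegrableOn u (Ioc 0 ℓ) := by
          rw [integrableOn_Ioc_iff_integrableOn_Ioo]
          exact hu.integrable one_le_two
        exact (this.mono_set (Ioc_subset_Ioc_right hx.2)).norm
    have m1 : MemLp (fun s => a s * Y s + W s) 2 (μ₀ ℓ) :=
      (MemLp.mul_continuousOn_μ₀ (hac.memLp.restrict _) cY).add (ContinuousOn.memLp_μ₀ cW)
    have m2 : MemLp (fun s => -(a s * W s) - ρ ^ 2 * Y s) 2 (μ₀ ℓ) :=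
      (MemLp.mul_continuousOn_μ₀ (hac.memLp.restrict _) cW).neg.sub
        ((ContinuousOn.memLp_μ₀ cY).const_mul _)
    calc N x ≤ (∫ s in Ioc 0 x, ‖a s * Y s + W s‖) +
          ∫ s in Ioc 0 x, ‖-(a s * W s) - ρ ^ 2 * Y s‖ := by
          rw [hN]
          refine add_le_add ?_ ?_
          · rw [iY x hx, intervalIntegral.integral_of_le hx.1]
            exact norm_integral_le_integral_norm _
          · rw [iW x hx, intervalIntegral.integral_of_le hx.1]
            exact norm_integral_le_integral_norm _
      _ = ∫ s in Ioc 0 x, (‖a s * Y s + W s‖ + ‖-(a s * W s) - ρ ^ 2 * Y s‖) :=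
          (integral_add (hsub _ m1) (hsub _ m2)).symm
      _ ≤ ∫ s in Ioc 0 x, ‖k s‖ * N s := by
          refine integral_mono_ae ((hsub _ m1).add (hsub _ m2)) (hkN x hx) ?_
          have hne : ∀ᵐ s, s ≠ x := by simp [ae_iff, measure_singleton]
          filter_upwards [ae_restrict_mem measurableSet_Ioc, ae_restrict_of_ae hne] with s hs hsx
          have hs' : s ∈ Ioo 0 ℓ := ⟨hs.1, (lt_of_le_of_ne hs.2 hsx).trans_le hx.2⟩
          have b1 := norm_add_le (a s * Y s) (W s)
          have b2 := norm_sub_le (-(a s * W s)) (ρ ^ 2 * Y s)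
          rw [norm_neg, norm_mul, norm_mul] at b2
          rw [norm_mul] at b1
          rw [hk, indicator_of_mem hs', Complex.norm_real, Real.norm_of_nonneg (by positivity), hN]
          dsimp only
          nlinarith [mul_nonneg (norm_nonneg (ρ ^ 2)) (norm_nonneg (W s)), norm_nonneg (Y s)]
  intro x hx
  have h := eq_zero_of_le_integral_mul hkL hN0
    (fun x hx => (le_abs_self _).trans (hM x hx)) hle x hx
  have h0 : ‖Y x‖ = 0 := le_antisymm (by linarith [norm_nonneg (W x)]) (norm_nonneg _)
  exact sub_eq_zero.1 (norm_eq_zero.1 h0)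

/-! ### Existence of the kernel -/

/-- The exponential solution in terms of `jost`. -/
def expSolution (a : ℝ → ℂ) (ρ : ℂ) (x : ℝ) : ℂ :=
  (1 / 2) * (jost a ρ x + jost a (-ρ) x + (jost (-a) ρ x - jost (-a) (-ρ) x))

/-- Half-sums and half-differences of z(ρ) and z(-ρ) decouple: C' = aC + iρS and S' = iρC - aS. Thus
(C, iρS) for a, and (S, iρC) for -a, both solve the system for a; the sum has initial data (1, iρ).
-/
theorem isExpSolution_expSolution (hℓ : 0 ≤ ℓ) (hf : IsImpedance ℓ f) {a : ℝ → ℂ} (ha : IsCoeff a)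
    (haf : a =ᵐ[μ₀ ℓ] logD f) (ρ : ℂ) : IsExpSolution ℓ f ρ (expSolution a ρ) := by
  obtain ⟨m1, d1⟩ := memW12_jost hℓ ha ρ
  obtain ⟨m2, d2⟩ := memW12_jost hℓ ha (-ρ)
  obtain ⟨m3, d3⟩ := memW12_jost hℓ ha.neg ρ
  obtain ⟨m4, d4⟩ := memW12_jost hℓ ha.neg (-ρ)
  obtain ⟨m4', d4'⟩ := m4.const_mul (-1)
  obtain ⟨m2', d2'⟩ := m2.const_mul (-1)
  obtain ⟨s12, e12⟩ := m1.add hℓ m2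
  obtain ⟨s34, e34⟩ := m3.add hℓ m4'
  obtain ⟨s, e⟩ := s12.add hℓ s34
  obtain ⟨t, g⟩ := s.const_mul (1 / 2)
  obtain ⟨s12', e12'⟩ := m1.add hℓ m2'
  obtain ⟨s34', e34'⟩ := m3.add hℓ m4
  obtain ⟨s', e'⟩ := s12'.add hℓ s34'
  obtain ⟨t', g'⟩ := s'.const_mul (Complex.I * ρ * (1 / 2))
  have hy : expSolution a ρ = fun x => 1 / 2 * (jost a ρ x + jost a (-ρ) x +
      (jost (-a) ρ x + -1 * jost (-a) (-ρ) x)) := by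
    funext x; rw [expSolution]; ring
  refine isExpSolution_of_system hℓ (hf.memLp_logD hℓ) (w := fun x => Complex.I * ρ * (1 / 2) *
    (jost a ρ x + -1 * jost a (-ρ) x + (jost (-a) ρ x + jost (-a) (-ρ) x))) (hy ▸ t) t' ?_ ?_ ?_ ?_
  · rw [hy]
    filter_upwards [d1, d2, d3, d4, e12, e34, e, haf] with x h1 h2 h3 h4 h12 h34 h ha
    rw [g, h, h12, h34, d4', h1, h2, h3, h4, ← ha]
    simp only [Pi.neg_apply, neg_neg]
    ring
  · rw [hy]
    filter_upwards [d1, d2, d3, d4, e12', e34', e', haf] with x h1 h2 h3 h4 h12 h34 h ha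
    rw [g', h, h12, h34, d2', h1, h2, h3, h4, ← ha]
    simp only [Pi.neg_apply, neg_neg]
    linear_combination (1 / 2 * ρ ^ 2 * (jost a ρ x + jost a (-ρ) x +
      (jost (-a) ρ x - jost (-a) (-ρ) x))) * Complex.I_sq
  · simp only [expSolution, jost_zero ha, jost_zero ha.neg]; norm_num
  · simp only [jost_zero ha, jost_zero ha.neg]; ring

theorem expTransform_eq_intervalIntegral {φ : ℝ → ℝ → ℂ} (hs : ∀ x t, x ≤ |t| → φ x t = 0) (ρ : ℂ)
    {x : ℝ} (hx : 0 ≤ x) :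
    expTransform φ ρ x = ∫ t in (-x)..x, φ x t * Complex.exp (Complex.I * ρ * t) := by
  rw [intervalIntegral.integral_of_le (by linarith), integral_Ioc_eq_integral_Ioo,
    setIntegral_eq_integral_of_forall_compl_eq_zero]
  · rfl
  · intro t ht
    rw [hs x t, zero_mul]
    by_contra! hlt
    exact ht (abs_lt.1 hlt)

theorem transKernel_eq_zero (a : ℝ → ℂ) (x t : ℝ) (h : x ≤ |t|) : transKernel a x t = 0 := by
  have h' : x ≤ |(-t)| := by rwa [abs_neg]
  simp [transKernel, goursat_eq_zero x t h, goursat_eq_zero x (-t) h']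

/-- Replacing t by -t rewrites the transforms at -ρ as transforms at ρ of the reflected slices. -/
theorem expSolution_eq {a : ℝ → ℂ} (ha : IsCoeff a) (ρ : ℂ) {x : ℝ} (hx : 0 ≤ x) :
    expSolution a ρ x = Complex.exp (Complex.I * ρ * x) +
      ∫ t in (-x)..x, transKernel a x t * Complex.exp (Complex.I * ρ * t) := by
  rw [← expTransform_eq_intervalIntegral (transKernel_eq_zero a) ρ hx]
  have hx' : x ∈ Icc 0 x := ⟨hx, le_rfl⟩
  have hneg : ∀ b : ℝ → ℂ, expTransform (goursat b) (-ρ) x =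
      ∫ t : ℝ, goursat b x (-t) * Complex.exp (Complex.I * ρ * t) := fun b => by
    rw [expTransform, ← integral_neg_eq_self]
    simp
  have hnegi : ∀ b : ℝ → ℂ, IsCoeff b →
      Integrable (fun t : ℝ => goursat b x (-t) * Complex.exp (Complex.I * ρ * t)) := fun b hb => by
    simpa using ((isSlice_goursat hb x).integrable (-ρ) hx').comp_neg
  have i1 := (isSlice_goursat ha x).integrable ρ hx'
  have i3 := (isSlice_goursat ha.neg x).integrable ρ hx'
  have key : expTransform (transKernel a) ρ x = 1 / 2 * (expTransform (goursat a) ρ x +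
      expTransform (goursat a) (-ρ) x + (expTransform (goursat (-a)) ρ x -
      expTransform (goursat (-a)) (-ρ) x)) := by
    have hsum := integral_add (i1.add (hnegi a ha)) (i3.sub (hnegi _ ha.neg))
    simp only [Pi.add_apply, Pi.sub_apply] at hsum
    rw [integral_add i1 (hnegi a ha), integral_sub i3 (hnegi _ ha.neg)] at hsum
    rw [hneg, hneg, expTransform, expTransform, expTransform, ← hsum, ← integral_const_mul]
    refine integral_congr_ae (ae_of_all _ fun t => ?_)
    simp only [transKernel]
    ring
  rw [key, expSolution]
  simp only [jost]
  ring

end Transmutation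
end

noncomputable section
namespace Transmutation

/-! ### Density of exponentials -/

variable {ℓ : ℝ} {f : ℝ → ℂ}

/-- The exponential `exp (iρ ·)` on `[-X, X]`. -/
def expMap (X ρ : ℝ) : C(Icc (-X) X, ℂ) :=
  ⟨fun t => Complex.exp (Complex.I * (ρ : ℂ) * ((t : ℝ) : ℂ)), by fun_prop⟩

theorem star_expMap (X ρ : ℝ) : star (expMap X ρ) = expMap X (-ρ) := by
  ext t
  simp [expMap, ← Complex.exp_conj]

/-- The star algebra generated by the exponentials. -/
def expSubalgebra (X : ℝ) : StarSubalgebra ℂ C(Icc (-X) X, ℂ) where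
  toSubalgebra := Algebra.adjoin ℂ (range (expMap X))
  star_mem' := by
    change Algebra.adjoin ℂ (range (expMap X)) ≤ star (Algebra.adjoin ℂ (range (expMap X)))
    refine Algebra.adjoin_le ?_
    rintro - ⟨ρ, rfl⟩
    refine Algebra.subset_adjoin ⟨-ρ, ?_⟩
    exact (star_expMap X ρ).symm

/-- Exponentials are closed under multiplication, so the algebra they generate is merely their
linear span. -/
theorem expSubalgebra_coe (X : ℝ) :
    Subalgebra.toSubmodule (expSubalgebra X).toSubalgebra = Submodule.span ℂ (range (expMap X)) := by
  apply Algebra.adjoin_eq_span_of_subset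
  refine Subset.trans ?_ Submodule.subset_span
  intro u hu
  refine Submonoid.closure_induction (fun _ => id) ⟨0, ?_⟩ ?_ hu
  · ext t; simp [expMap]
  · rintro - - - - ⟨ρ, rfl⟩ ⟨σ, rfl⟩
    refine ⟨ρ + σ, ?_⟩
    ext t
    simp only [expMap, ContinuousMap.coe_mk, ContinuousMap.mul_apply, ← Complex.exp_add]
    congr 1
    push_cast
    ring

theorem expSubalgebra_separatesPoints (X : ℝ) : (expSubalgebra X).SeparatesPoints := by
  intro s t hst
  have hne : (s : ℝ) - t ≠ 0 := sub_ne_zero.2 fun h => hst (Subtype.ext h)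
  -- At frequency π/(s-t) the values at s and t differ by the factor exp(iπ) = -1.
  refine ⟨_, ⟨expMap X (Real.pi / (s - t)), Algebra.subset_adjoin ⟨_, rfl⟩, rfl⟩, fun h => ?_⟩
  simp only [expMap, ContinuousMap.coe_mk] at h
  have h1 : Complex.exp (Complex.I * ((Real.pi / (s - t) : ℝ) : ℂ) * ((s : ℝ) : ℂ)) =
      Complex.exp (Complex.I * ((Real.pi / (s - t) : ℝ) : ℂ) * ((t : ℝ) : ℂ)) *
        Complex.exp (Real.pi * Complex.I) := by
    rw [← Complex.exp_add]
    congr 1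
    have hne' : ((s : ℝ) : ℂ) - ((t : ℝ) : ℂ) ≠ 0 := by exact_mod_cast hne
    push_cast
    field_simp
    ring
  rw [h1, Complex.exp_pi_mul_I] at h
  have h2 := Complex.exp_ne_zero (Complex.I * ((Real.pi / (s - t) : ℝ) : ℂ) * ((t : ℝ) : ℂ))
  have h3 : Complex.exp (Complex.I * ((Real.pi / (s - t) : ℝ) : ℂ) * ((t : ℝ) : ℂ)) = 0 := by
    linear_combination (-1 / 2 : ℂ) * h
  exact h2 h3

/-- A closed subspace of `C[-X, X]` that contains the exponentials is everything. -/
theorem mem_of_expMap_mem {X : ℝ} (S : Submodule ℂ C(Icc (-X) X, ℂ))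
    (hS : IsClosed (S : Set C(Icc (-X) X, ℂ))) (h : ∀ ρ, expMap X ρ ∈ S) (u : C(Icc (-X) X, ℂ)) :
    u ∈ S := by
  have hspan : Submodule.span ℂ (range (expMap X)) ≤ S := by
    rw [Submodule.span_le]
    rintro - ⟨ρ, rfl⟩
    exact h ρ
  have htop := ContinuousMap.starSubalgebra_topologicalClosure_eq_top_of_separatesPoints
    (expSubalgebra X) (expSubalgebra_separatesPoints X)
  have hu : u ∈ (expSubalgebra X).topologicalClosure := by rw [htop]; trivial
  have hu' : u ∈ closure ((expSubalgebra X : StarSubalgebra ℂ C(Icc (-X) X, ℂ)) :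
    Set C(Icc (-X) X, ℂ)) := hu
  refine closure_minimal ?_ hS hu'
  intro v hv
  refine hspan ?_
  rw [← expSubalgebra_coe]
  exact hv

/-- A square integrable function is determined by its integrals against exponentials. -/
theorem ae_eq_zero_of_integral_exp_eq_zero {x : ℝ} (hx : 0 < x) {d : ℝ → ℂ}
    (hd : MemLp d 2 (μ₁ x))
    (h : ∀ ρ : ℝ, ∫ t in Ioo (-x) x, d t * Complex.exp (Complex.I * ρ * t) = 0) :
    d =ᵐ[μ₁ x] 0 := by
  have hdi : Integrable d (μ₁ x) := hd.integrable one_le_two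
  have hle := neg_le_self hx.le
  have hint : ∀ u : C(Icc (-x) x, ℂ), Integrable (fun t => d t * IccExtend hle u t) (μ₁ x) :=
    fun u => by
      refine hdi.mul_bdd (c := ‖u‖) u.continuous.Icc_extend'.aestronglyMeasurable
        (ae_of_all _ fun t => u.norm_coe_le_norm _)
  let L : C(Icc (-x) x, ℂ) →ₗ[ℂ] ℂ :=
    { toFun := fun u => ∫ t in Ioo (-x) x, d t * IccExtend hle u t
      map_add' := fun u v => by
        rw [← integral_add (hint u) (hint v)]
        refine integral_congr_ae (ae_of_all _ fun t => ?_)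
        simp only [IccExtend, Function.comp_apply, ContinuousMap.add_apply]
        ring
      map_smul' := fun c u => by
        rw [RingHom.id_apply, smul_eq_mul, ← integral_const_mul]
        refine integral_congr_ae (ae_of_all _ fun t => ?_)
        simp only [IccExtend, Function.comp_apply, ContinuousMap.smul_apply, smul_eq_mul]
        ring }
  let Lc := L.mkContinuous (∫ t in Ioo (-x) x, ‖d t‖) fun u => by
    change ‖∫ t in Ioo (-x) x, d t * IccExtend hle u t‖ ≤ _
    refine (norm_integral_le_integral_norm _).trans ?_
    rw [← integral_mul_const]
    refine integral_mono_ae (hint u).norm (hdi.norm.mul_const _) (ae_of_all _ fun t => ?_)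
    dsimp only
    rw [norm_mul]
    gcongr
    exact u.norm_coe_le_norm _
  -- The kernel of a bounded functional is closed, and it contains the exponentials by hypothesis.
  have hall : ∀ u, Lc u = 0 := fun u =>
    mem_of_expMap_mem (LinearMap.ker Lc.toLinearMap) Lc.isClosed_ker (fun ρ => by
      refine Eq.trans (setIntegral_congr_fun measurableSet_Ioo fun t ht => ?_) (h ρ)
      rw [IccExtend_of_mem hle _ (Ioo_subset_Icc_self ht)]
      rfl) u
  have hzero := isOpen_Ioo.ae_eq_zero_of_integral_contDiff_smul_eq_zero
    (IntegrableOn.locallyIntegrableOn hdi) (fun g hg _ hgs => by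
    have hu := hall ⟨fun t => (g t : ℂ), by have := hg.continuous; fun_prop⟩
    refine Eq.trans ?_ hu
    change _ = ∫ t in Ioo (-x) x, d t * IccExtend hle _ t
    rw [← integral_indicator measurableSet_Ioo]
    refine integral_congr_ae (ae_of_all _ fun t => ?_)
    dsimp only
    by_cases ht : t ∈ Ioo (-x) x
    · rw [indicator_of_mem ht, IccExtend_of_mem hle _ (Ioo_subset_Icc_self ht),
        Complex.real_smul, mul_comm]
      rfl
    · rw [indicator_of_notMem ht, image_eq_zero_of_notMem_tsupport fun h => ht (hgs h), zero_smul])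
  rw [EventuallyEq, ae_restrict_iff' measurableSet_Ioo]
  exact hzero

/-! ### The triangle -/

theorem measurableSet_triangle (ℓ : ℝ) : MeasurableSet (triangle ℓ) :=
  (measurableSet_le measurable_const measurable_fst).inter
    ((measurableSet_le measurable_fst measurable_const).inter
      (measurableSet_le (by fun_prop) measurable_fst))

/-- Tonelli: the squared slice norms are at most C², and x runs over an interval of length ℓ. -/
theorem eLpNorm_triangle_le {G : ℝ → ℝ → ℂ} (hG : StronglyMeasurable (Function.uncurry G))
    {C : ENNReal} (hC : ∀ x ∈ Ioc 0 ℓ, eLpNorm (G x) 2 (μ₁ x) ≤ C) :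
    eLpNorm (fun p : ℝ × ℝ => G p.1 p.2) 2 (μT ℓ) ≤ C * ENNReal.ofReal ℓ ^ (1 / 2 : ℝ) := by
  have hslice : ∀ x ∈ Ioc 0 ℓ, ∫⁻ t in Ioo (-x) x, ‖G x t‖ₑ ^ (2 : ℝ) ≤ C ^ (2 : ℝ) := by
    intro x hx
    have h := hC x hx
    rw [eLpNorm_eq_lintegral_rpow_enorm_toReal two_ne_zero ENNReal.ofNat_ne_top,
      ENNReal.toReal_ofNat, one_div, ENNReal.rpow_inv_le_iff two_pos] at h
    exact h
  rw [eLpNorm_eq_lintegral_rpow_enorm_toReal two_ne_zero ENNReal.ofNat_ne_top,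
    ENNReal.toReal_ofNat, one_div, ENNReal.rpow_inv_le_iff two_pos,
    ENNReal.mul_rpow_of_nonneg _ _ two_pos.le, ← ENNReal.rpow_mul]
  norm_num only [inv_mul_cancel₀, ENNReal.rpow_one]
  have hmeas : Measurable fun p : ℝ × ℝ => ‖G p.1 p.2‖ₑ ^ (2 : ℝ) :=
    (hG.enorm).pow_const 2
  rw [← lintegral_indicator (measurableSet_triangle ℓ), Measure.volume_eq_prod,
    lintegral_prod _ (hmeas.indicator (measurableSet_triangle ℓ)).aemeasurable]
  calc ∫⁻ x, ∫⁻ t, (triangle ℓ).indicator (fun p => ‖G p.1 p.2‖ₑ ^ (2 : ℝ)) (x, t)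
      ≤ ∫⁻ x, (Ioc 0 ℓ).indicator (fun _ => C ^ (2 : ℝ)) x := by
        refine lintegral_mono_ae ?_
        have hne : ∀ᵐ x : ℝ, x ≠ 0 := by simp [ae_iff, measure_singleton]
        filter_upwards [hne] with x hx0
        by_cases hx : x ∈ Ioc 0 ℓ
        · rw [indicator_of_mem hx]
          refine le_trans (le_of_eq ?_) (hslice x hx)
          rw [setLIntegral_congr Ioo_ae_eq_Icc, ← lintegral_indicator measurableSet_Icc]
          congr 1 with t
          simp only [indicator_apply, triangle, mem_ofPred_eq, mem_Icc, hx.1.le, hx.2, true_and,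
            abs_le]
        · rw [indicator_of_notMem hx]
          have : ∀ t, (x, t) ∉ triangle ℓ := fun t ht =>
            hx ⟨lt_of_le_of_ne ht.1 (Ne.symm hx0), ht.2.1⟩
          simp [indicator_of_notMem (this _)]
    _ = C ^ (2 : ℝ) * ENNReal.ofReal ℓ := by
        rw [lintegral_indicator measurableSet_Ioc, lintegral_const, Measure.restrict_apply_univ,
          Real.volume_Ioc, sub_zero]

/-- Slicewise equality passes to the triangle only through a jointly measurable exceptional set, so
G is first replaced by a strongly measurable representative. -/
theorem ae_eq_triangle_of_slices {G H : ℝ → ℝ → ℂ}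
    (hG : AEStronglyMeasurable (fun p : ℝ × ℝ => G p.1 p.2) (μT ℓ))
    (hH : StronglyMeasurable (Function.uncurry H)) (h : ∀ x ∈ Ioc 0 ℓ, G x =ᵐ[μ₁ x] H x) :
    (fun p : ℝ × ℝ => G p.1 p.2) =ᵐ[μT ℓ] fun p => H p.1 p.2 := by
  obtain ⟨g, hg, hgG⟩ := hG
  refine hgG.trans ?_
  rw [EventuallyEq, ae_restrict_iff' (measurableSet_triangle ℓ)] at hgG ⊢
  have hms : MeasurableSet {p : ℝ × ℝ | p ∈ triangle ℓ → g p = H p.1 p.2} := by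
    have : {p : ℝ × ℝ | p ∈ triangle ℓ → g p = H p.1 p.2} =
        (triangle ℓ)ᶜ ∪ {p | g p = Function.uncurry H p} := by
      ext p
      simp only [mem_ofPred_eq, mem_union, mem_compl_iff, Function.uncurry]
      tauto
    rw [this]
    exact (measurableSet_triangle ℓ).compl.union (hg.measurableSet_eq_fun hH)
  rw [Measure.volume_eq_prod] at hgG ⊢
  rw [Measure.ae_prod_iff_ae_ae hms]
  have hne : ∀ᵐ x : ℝ, x ≠ 0 := by simp [ae_iff, measure_singleton]
  filter_upwards [Measure.ae_ae_of_ae_prod hgG, hne] with x hx hx0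
  have h1 : ∀ y : ℝ, ∀ᵐ t : ℝ, t ≠ y := fun y => by simp [ae_iff, measure_singleton]
  by_cases hxl : x ∈ Ioc 0 ℓ
  · have h2 := (ae_restrict_iff' measurableSet_Ioo).1 (h x hxl)
    filter_upwards [hx, h2, h1 x, h1 (-x)] with t ht1 ht2 ht3 ht4 ht
    rw [← ht1 ht]
    have h3 := abs_le.1 ht.2.2
    exact ht2 ⟨lt_of_le_of_ne h3.1 (Ne.symm ht4), lt_of_le_of_ne h3.2 ht3⟩
  · exact ae_of_all _ fun t ht => absurd ⟨lt_of_le_of_ne ht.1 (Ne.symm hx0), ht.2.1⟩ hxl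

/-! ### Existence and uniqueness of the kernel -/

theorem isTransmutationKernel_transKernel (hℓ : 0 ≤ ℓ) (hf : IsImpedance ℓ f) {a : ℝ → ℂ}
    (ha : IsCoeff a) (haf : a =ᵐ[μ₀ ℓ] logD f) : IsTransmutationKernel ℓ f (transKernel a) := by
  have hm := stronglyMeasurable_transKernel ha
  refine ⟨⟨hm.aestronglyMeasurable, ?_⟩, fun x hx => ⟨(stronglyMeasurable_slice hm
    x).aestronglyMeasurable, ?_⟩, fun ρ => ⟨expSolution a ρ,
    isExpSolution_expSolution hℓ hf ha haf ρ, fun x hx => expSolution_eq ha ρ hx.1.le⟩⟩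
  · exact (eLpNorm_triangle_le hm fun x hx => eLpNorm_transKernel_le ha hx).trans_lt
      (ENNReal.mul_lt_top ENNReal.ofReal_lt_top (by finiteness))
  · exact (eLpNorm_transKernel_le ha hx).trans_lt ENNReal.ofReal_lt_top

/-- Both kernels represent the same function e_f(ρ), so their difference is orthogonal to every
exponential with real frequency. -/
theorem IsTransmutationKernel.ae_eq (hℓ : 0 ≤ ℓ) (hf : IsImpedance ℓ f) {K K' : ℝ → ℝ → ℂ}
    (hK : IsTransmutationKernel ℓ f K) (hK' : IsTransmutationKernel ℓ f K') {x : ℝ}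
    (hx : x ∈ Ioc 0 ℓ) : K' x =ᵐ[μ₁ x] K x := by
  have hd : MemLp (fun t => K' x t - K x t) 2 (μ₁ x) := (hK'.slice x hx).sub (hK.slice x hx)
  have hexp : ∀ (ρ : ℝ) (k : ℝ → ℂ), MemLp k 2 (μ₁ x) →
      Integrable (fun t : ℝ => k t * Complex.exp (Complex.I * ρ * t)) (μ₁ x) := fun ρ k hk =>
    (hk.integrable one_le_two).mul_bdd (c := 1)
      (Continuous.aestronglyMeasurable (by fun_prop)) (ae_of_all _ fun t => by
        rw [mul_assoc, ← Complex.ofReal_mul, mul_comm, Complex.norm_exp_ofReal_mul_I])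
  have h0 := ae_eq_zero_of_integral_exp_eq_zero hx.1 hd fun ρ => by
    obtain ⟨y, hy, e⟩ := hK.representation ρ
    obtain ⟨y', hy', e'⟩ := hK'.representation ρ
    have h1 := hy.eqOn hℓ hf hy' ⟨hx.1.le, hx.2⟩
    rw [e x hx, e' x hx, add_right_inj, intervalIntegral.integral_of_le (by linarith [hx.1]),
      intervalIntegral.integral_of_le (by linarith [hx.1]), integral_Ioc_eq_integral_Ioo,
      integral_Ioc_eq_integral_Ioo] at h1
    simp_rw [sub_mul]
    rw [integral_sub (hexp ρ _ (hK'.slice x hx)) (hexp ρ _ (hK.slice x hx)), h1, sub_self]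
  filter_upwards [h0] with t ht
  exact sub_eq_zero.1 ht

theorem IsImpedance.isUniqueTransmutationKernel (hℓ : 0 ≤ ℓ) (hf : IsImpedance ℓ f) :
    IsUniqueTransmutationKernel ℓ f (kernel ℓ f) := by
  obtain ⟨a, ha, haf, -⟩ := hf.exists_coeff hℓ
  have h : IsTransmutationKernel ℓ f (kernel ℓ f) :=
    Classical.epsilon_spec ⟨_, isTransmutationKernel_transKernel hℓ hf ha haf⟩
  exact ⟨h, fun K' hK' x hx => h.ae_eq hℓ hf hK' hx⟩

theorem IsImpedance.kernel_ae_eq (hℓ : 0 ≤ ℓ) (hf : IsImpedance ℓ f) {a : ℝ → ℂ}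
    (ha : IsCoeff a) (haf : a =ᵐ[μ₀ ℓ] logD f) {x : ℝ} (hx : x ∈ Ioc 0 ℓ) :
    kernel ℓ f x =ᵐ[μ₁ x] transKernel a x :=
  ((hf.isUniqueTransmutationKernel hℓ).2 _
    (isTransmutationKernel_transKernel hℓ hf ha haf) x hx).symm

end Transmutation
end

noncomputable section
namespace Transmutation

/-! ### Integral operators on the triangle -/

variable {ℓ C : ℝ} {K K' : ℝ → ℝ → ℂ} {u v : ℝ → ℂ} {x : ℝ}

/-- A measurable kernel with slices bounded by `C` in `L²(-x, x)`. -/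
structure SliceBound (ℓ C : ℝ) (K : ℝ → ℝ → ℂ) : Prop where
  nonneg : 0 ≤ C
  meas : StronglyMeasurable (Function.uncurry K)
  bound : ∀ x ∈ Ioc 0 ℓ, eLpNorm (K x) 2 (μ₁ x) ≤ ENNReal.ofReal C

theorem SliceBound.le (hK : SliceBound ℓ C K) (hx : x ∈ Icc 0 ℓ) :
    eLpNorm (K x) 2 (μ₁ x) ≤ ENNReal.ofReal C := by
  rcases hx.1.eq_or_lt with rfl | h0
  · simp [μ₁]
  · exact hK.bound x ⟨h0, hx.2⟩

theorem SliceBound.memLp (hK : SliceBound ℓ C K) (hx : x ∈ Icc 0 ℓ) : MemLp (K x) 2 (μ₁ x) :=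
  ⟨(stronglyMeasurable_slice hK.meas x).aestronglyMeasurable,
    (hK.le hx).trans_lt ENNReal.ofReal_lt_top⟩

theorem μ₁_mono (hx : x ≤ ℓ) : μ₁ x ≤ μ₁ ℓ :=
  Measure.restrict_mono (Ioo_subset_Ioo (neg_le_neg hx) hx) le_rfl

theorem μ₀_le_μ₁ (hℓ : 0 ≤ ℓ) : μ₀ ℓ ≤ μ₁ ℓ :=
  Measure.restrict_mono (Ioo_subset_Ioo_left (by linarith)) le_rfl

/-- The integral operator with kernel `K`. -/
def intOp (K : ℝ → ℝ → ℂ) (u : ℝ → ℂ) (x : ℝ) : ℂ := ∫ t in Ioo (-x) x, K x t * u t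

theorem SliceBound.integrable (hK : SliceBound ℓ C K) (hu : MemLp u 2 (μ₁ ℓ))
    (hx : x ∈ Icc 0 ℓ) : Integrable (fun t => K x t * u t) (μ₁ x) :=
  MemLp.integrable_mul (hK.memLp hx) (hu.mono_measure (μ₁_mono hx.2))

theorem SliceBound.norm_intOp_le (hK : SliceBound ℓ C K) (hu : MemLp u 2 (μ₁ ℓ))
    (hx : x ∈ Icc 0 ℓ) : ‖intOp K u x‖ ≤ C * norm₂ u (μ₁ ℓ) := by
  have hu' := hu.mono_measure (μ₁_mono hx.2)
  refine (norm_integral_le_integral_norm _).trans ?_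
  simp_rw [norm_mul]
  refine (integral_norm_mul_norm_le (hK.memLp hx) hu').trans ?_
  refine mul_le_mul ?_ (ENNReal.toReal_mono hu.eLpNorm_ne_top
    (eLpNorm_mono_measure _ (μ₁_mono hx.2))) ENNReal.toReal_nonneg hK.nonneg
  exact ENNReal.toReal_le_of_le_ofReal hK.nonneg (hK.le hx)

theorem SliceBound.intOp_add (hK : SliceBound ℓ C K) (hu : MemLp u 2 (μ₁ ℓ))
    (hv : MemLp v 2 (μ₁ ℓ)) (hx : x ∈ Icc 0 ℓ) :
    intOp K (fun t => u t + v t) x = intOp K u x + intOp K v x := by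
  unfold intOp
  rw [← integral_add (hK.integrable hu hx) (hK.integrable hv hx)]
  simp_rw [mul_add]

theorem intOp_const_mul (K : ℝ → ℝ → ℂ) (c : ℂ) (u : ℝ → ℂ) (x : ℝ) :
    intOp K (fun t => c * u t) x = c * intOp K u x := by
  unfold intOp
  rw [← integral_const_mul]
  refine integral_congr_ae (ae_of_all _ fun t => ?_)
  dsimp only; ring

theorem intOp_congr (K : ℝ → ℝ → ℂ) (h : u =ᵐ[μ₁ ℓ] v) (hx : x ≤ ℓ) :
    intOp K u x = intOp K v x := by
  refine integral_congr_ae ?_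
  filter_upwards [ae_mono (μ₁_mono hx) h] with t ht
  rw [ht]

theorem intOp_sub_kernel {C' : ℝ} (hK : SliceBound ℓ C K) (hK' : SliceBound ℓ C' K')
    (hu : MemLp u 2 (μ₁ ℓ)) (hx : x ∈ Icc 0 ℓ) :
    intOp (fun x t => K x t - K' x t) u x = intOp K u x - intOp K' u x := by
  unfold intOp
  rw [← integral_sub (hK.integrable hu hx) (hK'.integrable hu hx)]
  simp_rw [sub_mul]

theorem stronglyMeasurable_intOp (hK : StronglyMeasurable (Function.uncurry K))
    (hu : StronglyMeasurable u) : StronglyMeasurable (intOp K u) := by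
  have h : intOp K u = fun x => ∫ t, {p : ℝ × ℝ | p.2 ∈ Ioo (-p.1) p.1}.indicator
      (fun p => Function.uncurry K p * u p.2) (x, t) := by
    funext x
    rw [intOp, ← integral_indicator measurableSet_Ioo]
    rfl
  rw [h]
  refine StronglyMeasurable.integral_prod_right ?_
  refine StronglyMeasurable.indicator (hK.mul (hu.comp_measurable measurable_snd)) ?_
  exact (measurableSet_lt measurable_fst.neg measurable_snd).inter
    (measurableSet_lt measurable_snd measurable_fst)

theorem exists_restriction_clm (hℓ : 0 ≤ ℓ) :
    ∃ R : Lp ℂ 2 (μ₁ ℓ) →L[ℂ] Lp ℂ 2 (μ₀ ℓ), ∀ u, R u =ᵐ[μ₀ ℓ] u := by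
  have hle := μ₀_le_μ₁ hℓ
  have hm : ∀ u : Lp ℂ 2 (μ₁ ℓ), MemLp u 2 (μ₀ ℓ) := fun u => (Lp.memLp u).mono_measure hle
  let L : Lp ℂ 2 (μ₁ ℓ) →ₗ[ℂ] Lp ℂ 2 (μ₀ ℓ) :=
    { toFun := fun u => (hm u).toLp u
      map_add' := fun u v => by
        refine Lp.ext ?_
        filter_upwards [(hm (u + v)).coeFn_toLp, (hm u).coeFn_toLp, (hm v).coeFn_toLp,
          ae_mono hle (Lp.coeFn_add u v), Lp.coeFn_add ((hm u).toLp u) ((hm v).toLp v)]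
          with x h1 h2 h3 h4 h5
        rw [h1, h5, h4, Pi.add_apply, Pi.add_apply, h2, h3]
      map_smul' := fun c u => by
        refine Lp.ext ?_
        filter_upwards [(hm (c • u)).coeFn_toLp, (hm u).coeFn_toLp,
          ae_mono hle (Lp.coeFn_smul c u), Lp.coeFn_smul c ((hm u).toLp u)] with x h1 h2 h3 h4
        rw [h1, RingHom.id_apply, h4, h3, Pi.smul_apply, Pi.smul_apply, h2] }
  refine ⟨L.mkContinuous 1 fun u => ?_, fun u => (hm u).coeFn_toLp⟩
  rw [one_mul]
  change ‖(hm u).toLp u‖ ≤ ‖u‖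
  rw [Lp.norm_toLp, Lp.norm_def]
  exact ENNReal.toReal_mono (Lp.eLpNorm_ne_top u) (eLpNorm_mono_measure _ hle)

/-- Cauchy–Schwarz on each slice bounds the image pointwise by a multiple of the L² norm of u, and
(0, ℓ) has finite measure. -/
theorem exists_intOp_clm (hK : SliceBound ℓ C K) :
    ∃ J : Lp ℂ 2 (μ₁ ℓ) →L[ℂ] Lp ℂ 2 (μ₀ ℓ), ∀ u, J u =ᵐ[μ₀ ℓ] intOp K u := by
  have hb : ∀ u : Lp ℂ 2 (μ₁ ℓ), ∀ᵐ x ∂μ₀ ℓ, ‖intOp K u x‖ ≤ C * ‖u‖ := fun u => by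
    filter_upwards [ae_restrict_mem measurableSet_Ioo] with x hx
    exact hK.norm_intOp_le (Lp.memLp u) (Ioo_subset_Icc_self hx)
  have hm : ∀ u : Lp ℂ 2 (μ₁ ℓ), MemLp (intOp K u) 2 (μ₀ ℓ) := fun u =>
    (memLp_top_of_bound (stronglyMeasurable_intOp hK.meas
      (Lp.stronglyMeasurable u)).aestronglyMeasurable _ (hb u)).mono_exponent le_top
  let L : Lp ℂ 2 (μ₁ ℓ) →ₗ[ℂ] Lp ℂ 2 (μ₀ ℓ) :=
    { toFun := fun u => (hm u).toLp _
      map_add' := fun u v => by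
        refine Lp.ext ?_
        filter_upwards [(hm (u + v)).coeFn_toLp, (hm u).coeFn_toLp, (hm v).coeFn_toLp,
          Lp.coeFn_add ((hm u).toLp _) ((hm v).toLp _), ae_restrict_mem measurableSet_Ioo]
          with x h1 h2 h3 h5 hx
        rw [h1, h5, Pi.add_apply, h2, h3, intOp_congr K (Lp.coeFn_add u v) hx.2.le]
        exact hK.intOp_add (Lp.memLp u) (Lp.memLp v) (Ioo_subset_Icc_self hx)
      map_smul' := fun c u => by
        refine Lp.ext ?_
        filter_upwards [(hm (c • u)).coeFn_toLp, (hm u).coeFn_toLp,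
          Lp.coeFn_smul c ((hm u).toLp _), ae_restrict_mem measurableSet_Ioo] with x h1 h2 h4 hx
        rw [h1, RingHom.id_apply, h4, Pi.smul_apply, h2, intOp_congr K (Lp.coeFn_smul c u) hx.2.le]
        exact intOp_const_mul K c u x }
  refine ⟨L.mkContinuous ((μ₀ ℓ).real univ ^ (2 : ENNReal).toReal⁻¹ * C) fun u => ?_,
    fun u => (hm u).coeFn_toLp⟩
  rw [mul_assoc]
  refine Lp.norm_le_of_ae_bound (mul_nonneg hK.nonneg (norm_nonneg u)) ?_
  filter_upwards [(hm u).coeFn_toLp, hb u] with x h1 h2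
  change ‖(hm u).toLp _ x‖ ≤ _
  rwa [h1]

/-! ### Continuous functions -/

/-- The extension of a function on `[-ℓ, ℓ]` by its boundary values. -/
abbrev extend (hℓ : 0 < ℓ) (u : C(Icc (-ℓ) ℓ, ℂ)) : ℝ → ℂ := IccExtend (neg_le_self hℓ.le) u

theorem norm_extend_le (hℓ : 0 < ℓ) (u : C(Icc (-ℓ) ℓ, ℂ)) (x : ℝ) : ‖extend hℓ u x‖ ≤ ‖u‖ :=
  u.norm_coe_le_norm _

theorem continuous_extend (hℓ : 0 < ℓ) (u : C(Icc (-ℓ) ℓ, ℂ)) : Continuous (extend hℓ u) :=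
  u.continuous.Icc_extend'

theorem memLp_extend (hℓ : 0 < ℓ) (u : C(Icc (-ℓ) ℓ, ℂ)) : MemLp (extend hℓ u) 2 (μ₁ ℓ) :=
  (memLp_top_of_bound (continuous_extend hℓ u).aestronglyMeasurable ‖u‖
    (ae_of_all _ (norm_extend_le hℓ u))).mono_exponent le_top

theorem norm₂_extend_le (hℓ : 0 < ℓ) (u : C(Icc (-ℓ) ℓ, ℂ)) :
    norm₂ (extend hℓ u) (μ₁ ℓ) ≤ √(2 * ℓ) * ‖u‖ := by
  refine ENNReal.toReal_le_of_le_ofReal (by positivity) ?_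
  refine (eLpNorm_le_of_ae_bound (ae_of_all _ (norm_extend_le hℓ u))).trans ?_
  rw [μ₁_univ, ENNReal.ofReal_mul (Real.sqrt_nonneg _), Real.sqrt_eq_rpow,
    ← ENNReal.ofReal_rpow_of_nonneg (by positivity) (by norm_num), ENNReal.toReal_ofNat, one_div]

theorem SliceBound.norm_intOp_extend_le (hK : SliceBound ℓ C K) (hℓ : 0 < ℓ)
    (u : C(Icc (-ℓ) ℓ, ℂ)) (hx : x ∈ Icc 0 ℓ) :
    ‖intOp K (extend hℓ u) x‖ ≤ C * √(2 * ℓ) * ‖u‖ := by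
  refine (hK.norm_intOp_le (memLp_extend hℓ u) hx).trans ?_
  rw [mul_assoc]
  exact mul_le_mul_of_nonneg_left (norm₂_extend_le hℓ u) hK.nonneg

theorem SliceBound.intOp_extend_add (hK : SliceBound ℓ C K) (hℓ : 0 < ℓ)
    (u v : C(Icc (-ℓ) ℓ, ℂ)) (hx : x ∈ Icc 0 ℓ) :
    intOp K (extend hℓ (u + v)) x = intOp K (extend hℓ u) x + intOp K (extend hℓ v) x :=
  hK.intOp_add (memLp_extend hℓ u) (memLp_extend hℓ v) hx

theorem intOp_extend_smul (K : ℝ → ℝ → ℂ) (hℓ : 0 < ℓ) (c : ℂ) (u : C(Icc (-ℓ) ℓ, ℂ)) (x : ℝ) :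
    intOp K (extend hℓ (c • u)) x = c * intOp K (extend hℓ u) x :=
  intOp_const_mul K c _ x

/-- By the uniform slice bound, the functions u with continuous image form a closed subspace; it
contains the exponentials, hence everything. -/
theorem SliceBound.continuousOn_intOp (hK : SliceBound ℓ C K) (hℓ : 0 < ℓ)
    (hexp : ∀ ρ, ContinuousOn (intOp K (extend hℓ (expMap ℓ ρ))) (Icc 0 ℓ))
    (u : C(Icc (-ℓ) ℓ, ℂ)) : ContinuousOn (intOp K (extend hℓ u)) (Icc 0 ℓ) := by
  let S : Submodule ℂ C(Icc (-ℓ) ℓ, ℂ) :=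
    { carrier := {u | ContinuousOn (intOp K (extend hℓ u)) (Icc 0 ℓ)}
      add_mem' := fun {u v} hu hv => (hu.add hv).congr fun x hx => hK.intOp_extend_add hℓ u v hx
      zero_mem' := (continuousOn_const (c := (0 : ℂ))).congr fun x _ => by
        simp [intOp, extend, IccExtend]
      smul_mem' := fun c u hu => (hu.const_mul c).congr fun x _ => intOp_extend_smul K hℓ c u x }
  refine mem_of_expMap_mem S (isClosed_of_closure_subset fun u hu => ?_) hexp u
  refine continuousOn_of_uniform_approx_of_continuousOn fun V hV => ?_
  obtain ⟨ε, hε, hεV⟩ := Metric.mem_uniformity_dist.1 hV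
  have hC := hK.nonneg
  obtain ⟨v, hv, huv⟩ := Metric.mem_closure_iff.1 hu (ε / (C * √(2 * ℓ) + 1)) (by positivity)
  refine ⟨_, hv, fun x hx => hεV ?_⟩
  have h1 : intOp K (extend hℓ u) x = intOp K (extend hℓ (u - v)) x + intOp K (extend hℓ v) x := by
    rw [← hK.intOp_extend_add hℓ _ _ hx, sub_add_cancel]
  rw [dist_eq_norm, h1, add_sub_cancel_right]
  refine (hK.norm_intOp_extend_le hℓ _ hx).trans_lt ?_
  rw [dist_eq_norm, lt_div_iff₀ (by positivity)] at huv
  nlinarith [norm_nonneg (u - v)]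

theorem exists_intOp_clm_continuousMap (hK : SliceBound ℓ C K) (hℓ : 0 < ℓ)
    (hexp : ∀ ρ, ContinuousOn (intOp K (extend hℓ (expMap ℓ ρ))) (Icc 0 ℓ)) :
    ∃ J : C(Icc (-ℓ) ℓ, ℂ) →L[ℂ] C(Icc (0 : ℝ) ℓ, ℂ),
      ∀ u (x : Icc (0 : ℝ) ℓ), J u x = extend hℓ u x + intOp K (extend hℓ u) x := by
  let L : C(Icc (-ℓ) ℓ, ℂ) →ₗ[ℂ] C(Icc (0 : ℝ) ℓ, ℂ) :=
    { toFun := fun u => ⟨fun x => extend hℓ u x + intOp K (extend hℓ u) x,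
        ((continuous_extend hℓ u).comp continuous_subtype_val).add
          (continuousOn_iff_continuous_domRestrict.1 (hK.continuousOn_intOp hℓ hexp u))⟩
      map_add' := fun u v => by
        ext x
        change extend hℓ u x + extend hℓ v x + intOp K (extend hℓ (u + v)) x =
          extend hℓ u x + intOp K (extend hℓ u) x + (extend hℓ v x + intOp K (extend hℓ v) x)
        rw [hK.intOp_extend_add hℓ u v x.2]
        ring
      map_smul' := fun c u => by
        ext x
        change c * extend hℓ u x + intOp K (extend hℓ (c • u)) x =
          c * (extend hℓ u x + intOp K (extend hℓ u) x)
        rw [intOp_extend_smul K hℓ c u x]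
        ring }
  refine ⟨L.mkContinuous (1 + C * √(2 * ℓ)) fun u => ?_, fun u x => rfl⟩
  have hC := hK.nonneg
  rw [ContinuousMap.norm_le _ (by positivity)]
  intro x
  rw [add_mul, one_mul]
  exact (norm_add_le _ _).trans (add_le_add (norm_extend_le hℓ u x)
    (hK.norm_intOp_extend_le hℓ u x.2))

/-- The image of exp(iρ·) is e_f(ρ, x) - exp(iρx), and e_f(ρ, ·) is continuous because it lies in
W^{1,2}. -/
theorem continuousOn_intOp_expMap {f a : ℝ → ℂ} (hℓ : 0 < ℓ) (hf : IsImpedance ℓ f)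
    (ha : IsCoeff a) (haf : a =ᵐ[μ₀ ℓ] logD f) (ρ : ℝ) :
    ContinuousOn (intOp (transKernel a) (extend hℓ (expMap ℓ ρ))) (Icc 0 ℓ) := by
  have hy := (isExpSolution_expSolution hℓ.le hf ha haf ρ).memW12.continuousOn hℓ.le
  have hE : Continuous fun x : ℝ => Complex.exp (Complex.I * ρ * x) := by fun_prop
  refine (hy.sub hE.continuousOn).congr fun x hx => ?_
  rw [Pi.sub_apply, expSolution_eq ha ρ hx.1, add_sub_cancel_left, intOp,
    intervalIntegral.integral_of_le (by linarith [hx.1]), integral_Ioc_eq_integral_Ioo]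
  refine setIntegral_congr_fun measurableSet_Ioo fun t ht => ?_
  rw [extend, IccExtend_of_mem _ _ (show t ∈ Icc (-ℓ) ℓ from
    ⟨by linarith [ht.1, hx.2], by linarith [ht.2, hx.2]⟩)]
  rfl

theorem transmute_eq {f a : ℝ → ℂ} (hℓ : 0 ≤ ℓ) (hf : IsImpedance ℓ f)
    (ha : IsCoeff a) (haf : a =ᵐ[μ₀ ℓ] logD f) (u : ℝ → ℂ) (hx : x ∈ Icc 0 ℓ) :
    transmute ℓ f u x = u x + intOp (transKernel a) u x := by
  rw [transmute, intOp, intervalIntegral.integral_of_le (by linarith [hx.1]),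
    integral_Ioc_eq_integral_Ioo]
  congr 1
  -- The kernels are compared only for x > 0; at x = 0 both integrals run over the empty interval.
  rcases hx.1.eq_or_lt with rfl | h0
  · simp
  · refine integral_congr_ae ?_
    filter_upwards [hf.kernel_ae_eq hℓ ha haf ⟨h0, hx.2⟩] with t ht
    rw [ht]

/-! ### Convergence -/

/-- The common value 1 at the origin makes g - f the integral of g' - f', so L² convergence of
derivatives controls the functions uniformly. -/
theorem norm_sub_le_of_impedance (hℓ : 0 ≤ ℓ) {f g : ℝ → ℂ} (hf : IsImpedance ℓ f)
    (hg : IsImpedance ℓ g) (hx : x ∈ Icc 0 ℓ) :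
    ‖g x - f x‖ ≤ norm₂ (fun s => deriv g s - deriv f s) (μ₀ ℓ) *
      norm₂ (fun _ : ℝ => (1 : ℂ)) (μ₀ ℓ) := by
  have hs : uIcc 0 x ⊆ uIcc 0 ℓ := by
    rw [uIcc_of_le hx.1, uIcc_of_le hℓ]; exact Icc_subset_Icc_right hx.2
  have hm : MemLp (fun s => deriv g s - deriv f s) 2 (μ₀ ℓ) :=
    hg.memW12.deriv_memLp.sub hf.memW12.deriv_memLp
  rw [hg.memW12.eq_integral hℓ hx, hf.memW12.eq_integral hℓ hx, hg.normalized, hf.normalized,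
    add_sub_add_left_eq_sub, ← intervalIntegral.integral_sub
      ((hg.memW12.intervalIntegrable_deriv hℓ).mono_set hs)
      ((hf.memW12.intervalIntegrable_deriv hℓ).mono_set hs)]
  refine le_trans ?_ (integral_norm_mul_norm_le hm (memLp_const 1))
  rw [intervalIntegral.integral_of_le hx.1, ← integral_Ioc_eq_integral_Ioo]
  simp only [norm_one, mul_one]
  refine (norm_integral_le_integral_norm _).trans ?_
  refine setIntegral_mono_set ?_ (ae_of_all _ fun s => norm_nonneg _)
    (Ioc_subset_Ioc_right hx.2).eventuallyLE
  rw [integrableOn_Ioc_iff_integrableOn_Ioo]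
  exact (hm.integrable one_le_two).norm

/-- Convergence of impedances implies convergence of logarithmic derivatives. -/
theorem tendsto_logD (hℓ : 0 < ℓ) {f : ℝ → ℂ} {F : ℕ → ℝ → ℂ} (hf : IsImpedance ℓ f)
    (hF : ∀ n, IsImpedance ℓ (F n)) (h : TendstoL2 ℓ (fun n => deriv (F n)) (deriv f)) :
    Tendsto (fun n => norm₂ (fun x => logD (F n) x - logD f x) (μ₀ ℓ)) atTop (𝓝 0) := by
  have cf := hf.memW12.continuousOn hℓ.le
  obtain ⟨x₀, hx₀, hmin⟩ := isCompact_Icc.exists_isMinOn (nonempty_Icc.2 hℓ.le) cf.norm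
  set δ := ‖f x₀‖ with hδ
  have hδ0 : 0 < δ := norm_pos_iff.2 (hf.ne_zero _ hx₀)
  set κ := norm₂ (fun _ : ℝ => (1 : ℂ)) (μ₀ ℓ) with hκ
  set d : ℕ → ℝ := fun n => norm₂ (fun s => deriv (F n) s - deriv f s) (μ₀ ℓ) with hd
  have hκ0 : 0 ≤ κ := ENNReal.toReal_nonneg
  have hd0 : ∀ n, 0 ≤ d n := fun n => ENNReal.toReal_nonneg
  have hdt : Tendsto d atTop (𝓝 0) := by
    have := (ENNReal.continuousAt_toReal ENNReal.zero_ne_top).tendsto.comp h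
    rw [ENNReal.toReal_zero] at this
    exact this
  have hA := hf.memLp_logD hℓ.le
  have hbt : Tendsto (fun n => 2 / δ * (d n + d n * κ * norm₂ (logD f) (μ₀ ℓ))) atTop (𝓝 0) := by
    have := (hdt.add ((hdt.mul_const κ).mul_const (norm₂ (logD f) (μ₀ ℓ)))).const_mul (2 / δ)
    simpa using this
  have hsmall : ∀ᶠ n in atTop, d n * κ < δ / 2 := by
    have := hdt.mul_const κ
    rw [zero_mul] at this
    exact this.eventually_lt_const (by positivity)
  refine squeeze_zero' (Eventually.of_forall fun n => ENNReal.toReal_nonneg) ?_ hbt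
  filter_upwards [hsmall] with n hn
  have hm : MemLp (fun s => deriv (F n) s - deriv f s) 2 (μ₀ ℓ) :=
    (hF n).memW12.deriv_memLp.sub hf.memW12.deriv_memLp
  set G : ℝ → ℝ := fun x => ‖deriv (F n) x - deriv f x‖ + (d n * κ) * ‖logD f x‖ with hG
  have hm2 : MemLp (fun x => (d n * κ) * ‖logD f x‖) 2 (μ₀ ℓ) := hA.norm.const_mul _
  have hGm : MemLp G 2 (μ₀ ℓ) := hm.norm.add hm2
  have h1 : ∀ᵐ x ∂μ₀ ℓ, ‖logD (F n) x - logD f x‖ ≤ 2 / δ * ‖G x‖ := by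
    filter_upwards [ae_restrict_mem measurableSet_Ioo] with x hx
    have hx' := Ioo_subset_Icc_self hx
    have hne := (hF n).ne_zero x hx'
    have hne' := hf.ne_zero x hx'
    have hsub := norm_sub_le_of_impedance hℓ.le hf (hF n) hx'
    have hfx : δ ≤ ‖f x‖ := hmin hx'
    have hFx : δ / 2 ≤ ‖F n x‖ := by
      have := norm_sub_norm_le (f x) (F n x)
      rw [norm_sub_rev] at this
      linarith
    -- Only the first factor involves 1/F n, and it is at most 2/δ once F n is within δ/2 of f,
    -- where δ is the minimum of |f|.
    have hid : logD (F n) x - logD f x =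
        (F n x)⁻¹ * ((deriv (F n) x - deriv f x) - (F n x - f x) * logD f x) := by
      unfold logD
      field_simp
      ring
    rw [hid, norm_mul, norm_inv, Real.norm_of_nonneg (by positivity : 0 ≤ G x)]
    refine mul_le_mul ?_ ?_ (norm_nonneg _) (by positivity)
    · rw [← inv_div]
      exact inv_anti₀ (by positivity) hFx
    · refine (norm_sub_le _ _).trans (add_le_add le_rfl ?_)
      rw [norm_mul]
      exact mul_le_mul_of_nonneg_right hsub (norm_nonneg _)
  have h2 := eLpNorm_le_mul_eLpNorm_of_ae_le_mul h1 2
  have h3 : norm₂ (fun x => logD (F n) x - logD f x) (μ₀ ℓ) ≤ 2 / δ * norm₂ G (μ₀ ℓ) := by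
    have := ENNReal.toReal_mono (ENNReal.mul_ne_top ENNReal.ofReal_ne_top hGm.eLpNorm_ne_top) h2
    rwa [ENNReal.toReal_mul, ENNReal.toReal_ofReal (by positivity)] at this
  refine h3.trans (mul_le_mul_of_nonneg_left ?_ (by positivity))
  have h4 := ENNReal.toReal_mono (ENNReal.add_ne_top.2 ⟨hm.norm.eLpNorm_ne_top,
    hm2.eLpNorm_ne_top⟩) (eLpNorm_add_le hm.norm.1 hm2.1 one_le_two)
  rw [ENNReal.toReal_add hm.norm.eLpNorm_ne_top hm2.eLpNorm_ne_top, eLpNorm_norm] at h4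
  refine h4.trans_eq ?_
  congr 1
  have h5 : (fun x => (d n * κ) * ‖logD f x‖) = (d n * κ) • fun x => ‖logD f x‖ := by
    funext x; simp
  rw [h5, eLpNorm_const_smul, eLpNorm_norm, ENNReal.toReal_mul, toReal_enorm,
    Real.norm_of_nonneg (mul_nonneg (hd0 n) hκ0)]

theorem norm₂_sub_coeff {f g a b : ℝ → ℂ} (haf : a =ᵐ[μ₀ ℓ] logD f) (hbg : b =ᵐ[μ₀ ℓ] logD g)
    (ha0 : ∀ x ∉ Ioo 0 ℓ, a x = 0) (hb0 : ∀ x ∉ Ioo 0 ℓ, b x = 0) :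
    norm₂ (b - a) volume = norm₂ (fun x => logD g x - logD f x) (μ₀ ℓ) := by
  have h1 : b - a = (Ioo 0 ℓ).indicator (b - a) := by
    refine (indicator_eq_self.2 fun x hx => ?_).symm
    by_contra hx'
    exact hx (by simp [ha0 x hx', hb0 x hx'])
  rw [norm₂, h1, eLpNorm_indicator_eq_eLpNorm_restrict measurableSet_Ioo]
  congr 1
  refine eLpNorm_congr_ae ?_
  filter_upwards [haf, hbg] with x h2 h3
  rw [Pi.sub_apply, h2, h3]

end Transmutation
end

noncomputable section
namespace Transmutation

/-! ### Continuous dependence of the kernel on the coefficient, and the convergence theorem -/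

theorem sliceBound_transKernel {a : ℝ → ℂ} (ha : IsCoeff a) (ℓ : ℝ) :
    SliceBound ℓ (2 * (sliceConst (norm₂ a volume) ℓ * norm₂ a volume)) (transKernel a) := by
  have hn : 0 ≤ norm₂ a volume := ENNReal.toReal_nonneg
  exact ⟨by unfold sliceConst; positivity, stronglyMeasurable_transKernel ha,
    fun x hx => eLpNorm_transKernel_le ha hx⟩

/-- The kernels depend continuously on the coefficient, uniformly in `x`. -/
theorem exists_sliceBound_sub {a : ℝ → ℂ} {b : ℕ → ℝ → ℂ} (ha : IsCoeff a)
    (hb : ∀ n, IsCoeff (b n)) (h : Tendsto (fun n => norm₂ (b n - a) volume) atTop (𝓝 0)) (ℓ : ℝ) :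
    ∃ c : ℕ → ℝ, Tendsto c atTop (𝓝 0) ∧ ∀ᶠ n in atTop,
      SliceBound ℓ (c n) fun x t => transKernel (b n) x t - transKernel a x t := by
  -- This bounds a and, once b n is within distance 1 of it, also b n, so one Lipschitz constant
  -- serves for almost all n.
  set Λ := norm₂ a volume + 1 with hΛ
  have hn : 0 ≤ norm₂ a volume := ENNReal.toReal_nonneg
  refine ⟨fun n => 2 * (sliceConst Λ ℓ * norm₂ (b n - a) volume), ?_, ?_⟩
  · simpa using (h.const_mul (sliceConst Λ ℓ)).const_mul 2
  filter_upwards [h.eventually_le_const one_pos] with n hn1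
  have hbn : norm₂ (b n) volume ≤ Λ := by
    have h1 := eLpNorm_add_le (μ := volume) (p := 2) ((hb n).sub ha).memLp.1 ha.memLp.1 one_le_two
    rw [sub_add_cancel] at h1
    have h2 := ENNReal.toReal_mono (ENNReal.add_ne_top.2
      ⟨((hb n).sub ha).memLp.eLpNorm_ne_top, ha.memLp.eLpNorm_ne_top⟩) h1
    rw [ENNReal.toReal_add ((hb n).sub ha).memLp.eLpNorm_ne_top ha.memLp.eLpNorm_ne_top] at h2
    refine h2.trans ?_
    rw [hΛ, add_comm]
    exact add_le_add le_rfl hn1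
  refine ⟨?_, (stronglyMeasurable_transKernel (hb n)).sub (stronglyMeasurable_transKernel ha),
    fun x hx => eLpNorm_transKernel_sub_le (hb n) ha hbn (by linarith) hx⟩
  have : 0 ≤ norm₂ (b n - a) volume := ENNReal.toReal_nonneg
  have : 0 ≤ Λ := by positivity
  unfold sliceConst
  positivity

end Transmutation
end

theorem mainTheorem11 (ℓ : ℝ) (hℓ : 0 < ℓ) (f : ℝ → ℂ) (F : ℕ → ℝ → ℂ)
    (hf : Transmutation.IsImpedance ℓ f)
    (hF : ∀ n, Transmutation.IsImpedance ℓ (F n))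
    (hFsmooth : ∀ n, ContDiffOn ℝ ∞ (F n) (Icc 0 ℓ))
    (hconv : Transmutation.ImpedanceTendsto ℓ F f) :
    -- the kernels `K_f` and `K_{F n}` exist and are unique
    (Transmutation.IsUniqueTransmutationKernel ℓ f (Transmutation.kernel ℓ f) ∧
      ∀ n, Transmutation.IsUniqueTransmutationKernel ℓ (F n) (Transmutation.kernel ℓ (F n))) ∧
    -- strong operator convergence in `B(L²(-ℓ, ℓ), L²(0, ℓ))`
    (∃ (T : Lp ℂ 2 (Transmutation.μ₁ ℓ) →L[ℂ] Lp ℂ 2 (Transmutation.μ₀ ℓ))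
      (Tn : ℕ → Lp ℂ 2 (Transmutation.μ₁ ℓ) →L[ℂ] Lp ℂ 2 (Transmutation.μ₀ ℓ)),
      Transmutation.IsTransmutationL2 ℓ f T ∧
      (∀ n, Transmutation.IsTransmutationL2 ℓ (F n) (Tn n)) ∧
      ∀ u, Tendsto (fun n => Tn n u) atTop (𝓝 (T u))) ∧
    -- strong operator convergence in `B(C[-ℓ, ℓ], C[0, ℓ])`
    (∃ (S : C(Icc (-ℓ) ℓ, ℂ) →L[ℂ] C(Icc (0 : ℝ) ℓ, ℂ))
      (Sn : ℕ → C(Icc (-ℓ) ℓ, ℂ) →L[ℂ] C(Icc (0 : ℝ) ℓ, ℂ)),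
      Transmutation.IsTransmutationC ℓ hℓ f S ∧
      (∀ n, Transmutation.IsTransmutationC ℓ hℓ (F n) (Sn n)) ∧
      ∀ u, Tendsto (fun n => Sn n u) atTop (𝓝 (S u))) ∧
    -- weak convergence of the kernels in `L²` of the triangle
    (∃ (k : Lp ℂ 2 (Transmutation.μT ℓ)) (kn : ℕ → Lp ℂ 2 (Transmutation.μT ℓ)),
      k =ᵐ[Transmutation.μT ℓ] (fun p => Transmutation.kernel ℓ f p.1 p.2) ∧
      (∀ n, kn n =ᵐ[Transmutation.μT ℓ] (fun p => Transmutation.kernel ℓ (F n) p.1 p.2)) ∧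
      Tendsto (fun n => toWeakSpace ℂ (Lp ℂ 2 (Transmutation.μT ℓ)) (kn n)) atTop
        (𝓝 (toWeakSpace ℂ (Lp ℂ 2 (Transmutation.μT ℓ)) k))) := by
  open Transmutation in
  obtain ⟨a, ha, haf, ha0⟩ := hf.exists_coeff hℓ.le
  choose b hb hbF hb0 using fun n => (hF n).exists_coeff hℓ.le
  have hab : Tendsto (fun n => norm₂ (b n - a) volume) atTop (𝓝 0) := by
    simp_rw [fun n => norm₂_sub_coeff haf (hbF n) ha0 (hb0 n)]
    exact tendsto_logD hℓ hf hF hconv.tendsto.2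
  obtain ⟨c, hc, hcb⟩ := exists_sliceBound_sub ha hb hab ℓ
  have hK := sliceBound_transKernel ha ℓ
  have hKn := fun n => sliceBound_transKernel (hb n) ℓ
  have hu := hf.isUniqueTransmutationKernel hℓ.le
  have hun := fun n => (hF n).isUniqueTransmutationKernel hℓ.le
  refine ⟨⟨hu, hun⟩, ?_, ?_, ?_⟩
  · obtain ⟨R, hR⟩ := exists_restriction_clm hℓ.le
    obtain ⟨J, hJ⟩ := exists_intOp_clm hK
    choose Jn hJn using fun n => exists_intOp_clm (hKn n)
    have hT : ∀ {g e : ℝ → ℂ} (_ : IsImpedance ℓ g) (_ : IsCoeff e) (_ : e =ᵐ[μ₀ ℓ] logD g)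
        {Q : Lp ℂ 2 (μ₁ ℓ) →L[ℂ] Lp ℂ 2 (μ₀ ℓ)} (_ : ∀ u, Q u =ᵐ[μ₀ ℓ] intOp (transKernel e) u),
        IsTransmutationL2 ℓ g (R + Q) := by
      intro g e hg he heg Q hQ u
      filter_upwards [Lp.coeFn_add (R u) (Q u), hR u, hQ u, ae_restrict_mem measurableSet_Ioo]
        with x h1 h2 h3 hx
      rw [transmute_eq hℓ.le hg he heg u (Ioo_subset_Icc_self hx), ← h3, ← h2]
      exact h1
    refine ⟨R + J, fun n => R + Jn n, hT hf ha haf hJ, fun n => hT (hF n) (hb n) (hbF n) (hJn n),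
      fun u => ?_⟩
    -- The restriction part does not depend on n; only the integral operators have to converge.
    refine (tendsto_const_nhds (x := R u)).add ?_
    rw [tendsto_iff_norm_sub_tendsto_zero]
    have hlim : Tendsto (fun n => (μ₀ ℓ).real univ ^ (2 : ENNReal).toReal⁻¹ * (c n * ‖u‖)) atTop
        (𝓝 0) := by
      simpa using (hc.mul_const ‖u‖).const_mul ((μ₀ ℓ).real univ ^ (2 : ENNReal).toReal⁻¹)
    refine squeeze_zero' (Eventually.of_forall fun n => norm_nonneg _) ?_ hlim
    filter_upwards [hcb] with n hn
    refine Lp.norm_le_of_ae_bound (mul_nonneg hn.nonneg (norm_nonneg u)) ?_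
    filter_upwards [Lp.coeFn_sub (Jn n u) (J u), hJn n u, hJ u, ae_restrict_mem measurableSet_Ioo]
      with x h1 h2 h3 hx
    have hx' := Ioo_subset_Icc_self hx
    change ‖(Jn n u - J u : Lp ℂ 2 (μ₀ ℓ)) x‖ ≤ _
    rw [h1, Pi.sub_apply, h2, h3, ← intOp_sub_kernel (hKn n) hK (Lp.memLp u) hx']
    exact hn.norm_intOp_le (Lp.memLp u) hx'
  · obtain ⟨S, hS⟩ := exists_intOp_clm_continuousMap hK hℓ
      (continuousOn_intOp_expMap hℓ hf ha haf)
    choose Sn hSn using fun n => exists_intOp_clm_continuousMap (hKn n) hℓ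
      (continuousOn_intOp_expMap hℓ (hF n) (hb n) (hbF n))
    refine ⟨S, Sn, fun u x => ?_, fun n u x => ?_, fun u => ?_⟩
    · rw [hS, transmute_eq hℓ.le hf ha haf _ x.2]
    · rw [hSn, transmute_eq hℓ.le (hF n) (hb n) (hbF n) _ x.2]
    rw [tendsto_iff_norm_sub_tendsto_zero]
    have hlim : Tendsto (fun n => c n * √(2 * ℓ) * ‖u‖) atTop (𝓝 0) := by
      simpa using (hc.mul_const √(2 * ℓ)).mul_const ‖u‖
    refine squeeze_zero' (Eventually.of_forall fun n => norm_nonneg _) ?_ hlim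
    filter_upwards [hcb] with n hn
    have hc0 := hn.nonneg
    rw [ContinuousMap.norm_le _ (by positivity)]
    intro x
    rw [ContinuousMap.sub_apply, hS, hSn, add_sub_add_left_eq_sub,
      ← intOp_sub_kernel (hKn n) hK (memLp_extend hℓ u) x.2]
    exact hn.norm_intOp_extend_le hℓ u x.2
  · have hae : (fun p : ℝ × ℝ => kernel ℓ f p.1 p.2) =ᵐ[μT ℓ] fun p => transKernel a p.1 p.2 :=
      ae_eq_triangle_of_slices hu.1.memLp.1 hK.meas fun x hx => hf.kernel_ae_eq hℓ.le ha haf hx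
    have haen : ∀ n, (fun p : ℝ × ℝ => kernel ℓ (F n) p.1 p.2) =ᵐ[μT ℓ]
        fun p => transKernel (b n) p.1 p.2 := fun n =>
      ae_eq_triangle_of_slices (hun n).1.memLp.1 (hKn n).meas
        fun x hx => (hF n).kernel_ae_eq hℓ.le (hb n) (hbF n) hx
    refine ⟨hu.1.memLp.toLp _, fun n => (hun n).1.memLp.toLp _, hu.1.memLp.coeFn_toLp,
      fun n => (hun n).1.memLp.coeFn_toLp, ?_⟩
    -- Weak convergence is deduced from convergence in norm, which the uniform slice bounds provide.
    refine ((toWeakSpaceCLM ℂ (Lp ℂ 2 (μT ℓ))).continuous.tendsto _).comp ?_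
    rw [Lp.tendsto_Lp_iff_tendsto_eLpNorm'']
    have hlim : Tendsto (fun n => ENNReal.ofReal (c n) * ENNReal.ofReal ℓ ^ (1 / 2 : ℝ)) atTop
        (𝓝 0) := by
      have h1 := ENNReal.tendsto_ofReal hc
      rw [ENNReal.ofReal_zero] at h1
      have h2 := ENNReal.Tendsto.mul_const (b := ENNReal.ofReal ℓ ^ (1 / 2 : ℝ)) h1
        (Or.inr (by finiteness))
      rwa [zero_mul] at h2
    refine tendsto_of_tendsto_of_tendsto_of_le_of_le' tendsto_const_nhds hlim
      (Eventually.of_forall fun n => zero_le) ?_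
    filter_upwards [hcb] with n hn
    refine le_trans (le_of_eq (eLpNorm_congr_ae ?_)) (eLpNorm_triangle_le hn.meas hn.bound)
    filter_upwards [hae, haen n] with p h1 h2
    rw [Pi.sub_apply, h1, h2]
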